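/- Let $\mathcal G$ be a weighted digraph on $\{1,\dots,N\}$ with weights $w_{ij}\ge 0$ (an edge $(i,j)$ being present iff $w_{ij}>0$) that is weight-balanced ($\sum_j w_{ij}=\sum_j w_{ji}$ for every $i$) and strongly connected, and let $\sigma_1,\dots,\sigma_N\in(0,1)$. Each agent $i$ has a state $x_i$, a last-broadcast state $\hat x_i$ and a clock variable $\chi_i$, all real; put $q=(x_i,\hat x_i,\chi_i)_{i=1}^N\in\mathbb R^{3N}$, $e_i=x_i-\hat x_i$, $\hat z_i=\sum_j w_{ij}(\hat x_i-\hat x_j)$ and $\hat\phi_i=\sum_j w_{ij}(\hat x_i-\hat x_j)^2$. Consider the hybrid system $\mathcal H=(C,f,D,G)$ in which * while $q\in C=\{q:\chi_i\ge 0 \text{ for all } i\}$, the state may flow according to $\dot x_i=-\hat z_i$, $\dot{\hat x}_i=0$, $\dot\chi_i=\sigma_i\hat\phi_i+2e_i\hat z_i$ for all $i$; * when $q\in D=\bigcup_i D_i$ with $D_i=\{q:\chi_i=0 \text{ and } \hat x_i\ne x_i\}$, the state may jump to any element of $G(q)=\{g_i(q): q\in D_i\}$, where $g_i$ replaces $\hat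 x_i$ by $x_i$ and changes nothing else. A trajectory is a maximal solution of $\mathcal H$, that is, a hybrid arc $q(t,j)$ on a hybrid time domain (with $t$ the elapsed time and $j$ the number of jumps), starting from $\hat x_i=x_i$ and $\chi_i=0$ for all $i$, with arbitrary $x\in\mathbb R^N$. **Theorem (Global Asymptotic Convergence).** Every trajectory is defined for arbitrarily large times $t$ (so there is no Zeno behaviour), and it converges asymptotically to the set $\{q:\hat\phi_i=0 \text{ for all } i\}$: the distance from $q(t,j)$ to this set tends to $0$ as $t+j\to\infty$ along the domain of the trajectory. That is, the last-broadcast states reach consensus: $\hat x_i(t,j)-\hat x_k(t,j)\to 0$ for all $i,k$ as $t+j\to\infty$. -/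

import Mathlib

noncomputable section

/-! ### Hybrid systems -/

/-- A hybrid system `(C, f, D, G)` on a state space `X`: flow set `C`, flow map `f`,
jump set `D` and set-valued jump map `G`. -/
structure HybridSystem (X : Type*) where
  flowSet : Set X
  flowMap : X → X
  jumpSet : Set X
  jumpMap : X → Set X

/-- A compact hybrid time domain: `⋃_{j < J} [t_j, t_{j+1}] × {j}` for some `J ≥ 1` and
times `0 = t_0 ≤ t_1 ≤ ⋯ ≤ t_J`. -/
def IsCompactHybridTimeDomain (E : Set (ℝ × ℕ)) : Prop :=
  ∃ (J : ℕ) (t : ℕ → ℝ), 0 < J ∧ t 0 = 0 ∧ (∀ j < J, t j ≤ t (j + 1)) ∧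
    E = {p | p.2 < J ∧ p.1 ∈ Set.Icc (t p.2) (t (p.2 + 1))}

/-- A hybrid time domain: a set all of whose truncations `E ∩ ([0,T] × {0,…,J})`,
`(T,J) ∈ E`, are compact hybrid time domains, and whose points are ordered by
`(t, j) ≤ (t', j') ↔ t ≤ t' ∧ j ≤ j'`. The ordering is the usual tacit convention; it only
excludes branching sets such as `[0, 5] × {0} ∪ {(3, 1)}`, whose truncations are compact
hybrid time domains although the set is not a growing union of such domains. -/
def IsHybridTimeDomain (E : Set (ℝ × ℕ)) : Prop :=
  (∀ p ∈ E, IsCompactHybridTimeDomain (E ∩ (Set.Icc 0 p.1 ×ˢ Set.Iic p.2))) ∧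
    ∀ p ∈ E, ∀ p' ∈ E, p ≤ p' ∨ p' ≤ p

/-- A hybrid arc: a function on a hybrid time domain which, for each `j`, is locally absolutely
continuous in `t` on `I^j = {t | (t, j) ∈ dom}` (absolutely continuous on every compact
subinterval). The values of `toFun` outside `dom` are irrelevant. -/
structure HybridArc (X : Type*) [PseudoMetricSpace X] where
  dom : Set (ℝ × ℕ)
  toFun : ℝ → ℕ → X
  isHybridTimeDomain : IsHybridTimeDomain dom
  locallyAC : ∀ (j : ℕ) (a b : ℝ), a ≤ b → Set.Icc a b ⊆ {t | (t, j) ∈ dom} →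
    AbsolutelyContinuousOnInterval (fun t => toFun t j) a b

/-- `I^j = {t | (t, j) ∈ dom φ}`. -/
def HybridArc.interval {X : Type*} [PseudoMetricSpace X] (φ : HybridArc X) (j : ℕ) : Set ℝ :=
  {t | (t, j) ∈ φ.dom}

/-- `φ` is a solution of the hybrid system `H`. -/
structure HybridSystem.IsSolution {X : Type*} [NormedAddCommGroup X] [NormedSpace ℝ X]
    (H : HybridSystem X) (φ : HybridArc X) : Prop where
  zero_mem : ((0 : ℝ), (0 : ℕ)) ∈ φ.dom
  init : φ.toFun 0 0 ∈ closure H.flowSet ∪ H.jumpSet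
  flow_mem : ∀ (j : ℕ), ∀ t ∈ interior (φ.interval j), φ.toFun t j ∈ H.flowSet
  flow_deriv : ∀ (j : ℕ), ∀ᵐ t ∂(MeasureTheory.volume : MeasureTheory.Measure ℝ),
    t ∈ interior (φ.interval j) →
      HasDerivAt (fun s => φ.toFun s j) (H.flowMap (φ.toFun t j)) t
  jump : ∀ (t : ℝ) (j : ℕ), (t, j) ∈ φ.dom → (t, j + 1) ∈ φ.dom →
    φ.toFun t j ∈ H.jumpSet ∧ φ.toFun t (j + 1) ∈ H.jumpMap (φ.toFun t j)

/-- `φ` is a maximal solution: it is not a proper restriction of another solution. -/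
def HybridSystem.IsMaximalSolution {X : Type*} [NormedAddCommGroup X] [NormedSpace ℝ X]
    (H : HybridSystem X) (φ : HybridArc X) : Prop :=
  H.IsSolution φ ∧
    ¬ ∃ ψ : HybridArc X, H.IsSolution ψ ∧ φ.dom ⊂ ψ.dom ∧
      ∀ (t : ℝ) (j : ℕ), (t, j) ∈ φ.dom → ψ.toFun t j = φ.toFun t j

/-- `φ` asymptotically converges to the set `A`: its distance to `A` tends to `0`
as `t + j → ∞` along `dom φ`. -/
def HybridArc.ConvergesTo {X : Type*} [PseudoMetricSpace X] (φ : HybridArc X) (A : Set X) : Prop :=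
  ∀ ε > (0 : ℝ), ∃ R : ℝ, ∀ (t : ℝ) (j : ℕ), (t, j) ∈ φ.dom → R ≤ t + j →
    Metric.infDist (φ.toFun t j) A < ε

/-! ### Weighted digraphs -/

/-- A weighted digraph on `N` vertices, given by its weighted adjacency matrix: the edges are the
pairs `(i, j)` with `w i j > 0`, and `w i j = 0` if `(i, j)` is not an edge. -/
structure WeightedDigraph (N : ℕ) where
  w : Matrix (Fin N) (Fin N) ℝ
  nonneg : ∀ i j, 0 ≤ w i j

/-- Out-degree equals in-degree at every vertex. -/
def WeightedDigraph.IsWeightBalanced {N : ℕ} (𝒢 : WeightedDigraph N) : Prop :=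
  ∀ i, ∑ j, 𝒢.w i j = ∑ j, 𝒢.w j i

/-- There is a directed path from every vertex to every vertex. -/
def WeightedDigraph.IsStronglyConnected {N : ℕ} (𝒢 : WeightedDigraph N) : Prop :=
  ∀ i j, Relation.ReflTransGen (fun a b => 0 < 𝒢.w a b) i j

/-- The Laplacian `L = D^out - A`. -/
def WeightedDigraph.laplacian {N : ℕ} (𝒢 : WeightedDigraph N) : Matrix (Fin N) (Fin N) ℝ :=
  Matrix.diagonal (fun i => ∑ j, 𝒢.w i j) - 𝒢.w

/-! ### The event-triggered closed loop -/

/-- The extended network state `q = (q_1, …, q_N) ∈ ℝ^{3N}`, `q_i = (x_i, x̂_i, χ_i)`,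
with the Euclidean norm. -/
abbrev NetState (N : ℕ) := EuclideanSpace ℝ (Fin N × Fin 3)

namespace NetState

/-- Assemble a network state from `x`, `x̂` and `χ`. -/
def mk {N : ℕ} (x xhat χ : Fin N → ℝ) : NetState N :=
  WithLp.toLp 2 (fun p => ![x p.1, xhat p.1, χ p.1] p.2)

/-- The state `x_i` of agent `i`. -/
def x {N : ℕ} (q : NetState N) (i : Fin N) : ℝ := q (i, 0)

/-- The last broadcast state `x̂_i` of agent `i`. -/
def xhat {N : ℕ} (q : NetState N) (i : Fin N) : ℝ := q (i, 1)

/-- The clock-like variable `χ_i` of agent `i`. -/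
def χ {N : ℕ} (q : NetState N) (i : Fin N) : ℝ := q (i, 2)

/-- The error `e_i = x_i - x̂_i`. -/
def e {N : ℕ} (q : NetState N) (i : Fin N) : ℝ := q.x i - q.xhat i

end NetState

namespace WeightedDigraph

/-- `ẑ_i = ∑_j w_ij (x̂_i - x̂_j)`. -/
def zhat {N : ℕ} (𝒢 : WeightedDigraph N) (q : NetState N) (i : Fin N) : ℝ :=
  ∑ j, 𝒢.w i j * (q.xhat i - q.xhat j)

/-- `φ̂_i = ∑_j w_ij (x̂_i - x̂_j)²`. -/
def phihat {N : ℕ} (𝒢 : WeightedDigraph N) (q : NetState N) (i : Fin N) : ℝ :=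
  ∑ j, 𝒢.w i j * (q.xhat i - q.xhat j) ^ 2

/-- `ẑ = L x̂`. -/
theorem zhat_eq_laplacian_mulVec {N : ℕ} (𝒢 : WeightedDigraph N) (q : NetState N) (i : Fin N) :
    𝒢.zhat q i = (𝒢.laplacian.mulVec q.xhat) i := by
  rw [laplacian, Matrix.sub_mulVec, Pi.sub_apply, Matrix.mulVec_diagonal]
  simp [zhat, Matrix.mulVec, dotProduct, mul_sub, Finset.sum_sub_distrib, Finset.sum_mul]

/-- The clock dynamics `γ_i = σ_i φ̂_i + 2 e_i ẑ_i`. -/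
def clockRate {N : ℕ} (𝒢 : WeightedDigraph N) (σ : Fin N → ℝ) (q : NetState N) (i : Fin N) : ℝ :=
  σ i * 𝒢.phihat q i + 2 * q.e i * 𝒢.zhat q i

end WeightedDigraph

/-- Agent `i` broadcasts when `χ_i = 0` and `x̂_i ≠ x_i`. -/
def triggerSet {N : ℕ} (i : Fin N) : Set (NetState N) :=
  {q | q.χ i = 0 ∧ q.xhat i ≠ q.x i}

/-- The effect of a broadcast of agent `i`: `x̂_i⁺ = x_i`, everything else is unchanged. -/
def broadcast {N : ℕ} (i : Fin N) (q : NetState N) : NetState N :=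
  NetState.mk q.x (Function.update q.xhat i (q.x i)) q.χ

/-- The closed-loop hybrid system under the dynamic event-triggered coordination algorithm with
design parameters `σ_i`. -/
def closedLoop {N : ℕ} (𝒢 : WeightedDigraph N) (σ : Fin N → ℝ) : HybridSystem (NetState N) where
  flowSet := {q | ∀ i, 0 ≤ q.χ i}
  flowMap q := NetState.mk (fun i => -𝒢.zhat q i) (fun _ => 0) (𝒢.clockRate σ q)
  jumpSet := ⋃ i, triggerSet i
  jumpMap q := {q' | ∃ i, q ∈ triggerSet i ∧ q' = broadcast i q}

/-- The initialization of the algorithm: `x̂_i = x_i` and `χ_i = 0` for every agent, with `x`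
arbitrary. -/
def IsInitialized {N : ℕ} (q : NetState N) : Prop :=
  ∀ i, q.xhat i = q.x i ∧ q.χ i = 0

/-- The set `{q | φ̂_i = 0 for all i}`. -/
def consensusSet {N : ℕ} (𝒢 : WeightedDigraph N) : Set (NetState N) :=
  {q | ∀ i, 𝒢.phihat q i = 0}

end

/-! Between jumps `x̂` is frozen, so `ẑ` and `φ̂` are constant, `x` is affine in time and `χ`
quadratic. Solutions are therefore handled through the closed form `WeightedDigraph.flow`.

No Zeno: the clock is designed so that `χ_i + e_i²` grows at rate exactly `σ_i φ̂_i`. Since `e_i` is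
minus the integral of `ẑ_i` since the last reset, at time `s`, Cauchy–Schwarz and `ẑ_i² ≤ d_i φ̂_i`
(`d_i` the out-degree) give `σ_i e_i² ≤ (t - s) d_i (χ_i + e_i²)` (`ErrorBound`). At a trigger `χ_i
= 0` and `e_i ≠ 0`, so `σ_i ≤ (t - s) d_i`: a minimal time between broadcasts of the same agent.
Jumps are then finite in number on bounded time, and a solution bounded in time could be extended by
a flow or a jump, against maximality.

Convergence: `V = ∑ (x_i² + χ_i)` is unchanged by jumps and, by weight balance, decreases along
flows at rate `∑ (1 - σ_i) φ̂_i`; hence it tends to some `m`. No invariance principle is used. After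
a broadcast of `i`, the growth of `χ_i + e_i²` is paid for by the decrease of `V`
(`e_sq_le_lyapunov_sub`), so later broadcasts of `i` move `x̂_i` very little. If `|x̂_a - x̂_b| ≥ ε`
on an edge at a late time, then during a window shorter than the minimal times of `a` and `b` each
value moves at most once, by at most `ε/4`; the gap stays at least `ε/2` and `V` drops by a fixed
amount, below `m`. Strong connectivity chains the edges. -/

/-! ### Derivatives and absolute continuity in coordinates -/

theorem hasDerivAt_euclideanSpace {ι : Type*} [Fintype ι] {f : ℝ → EuclideanSpace ℝ ι}
    {f' : EuclideanSpace ℝ ι} {t : ℝ} :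
    HasDerivAt f f' t ↔ ∀ p, HasDerivAt (fun s => f s p) (f' p) t := by
  rw [← hasDerivWithinAt_univ, hasDerivWithinAt_iff_hasFDerivWithinAt,
    hasFDerivWithinAt_euclidean]
  refine forall_congr' fun p => ?_
  rw [← hasDerivWithinAt_univ, hasDerivWithinAt_iff_hasFDerivWithinAt]
  apply iff_of_eq
  congr 1

theorem AbsolutelyContinuousOnInterval.euclideanSpace_apply {ι : Type*} [Fintype ι]
    {f : ℝ → EuclideanSpace ℝ ι} {a b : ℝ} (hf : AbsolutelyContinuousOnInterval f a b) (p : ι) :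
    AbsolutelyContinuousOnInterval (fun t => f t p) a b := by
  rw [absolutelyContinuousOnInterval_iff] at hf ⊢
  intro ε hε
  obtain ⟨δ, hδ, h⟩ := hf ε hε
  refine ⟨δ, hδ, fun E hE hEδ => lt_of_le_of_lt (Finset.sum_le_sum fun i _ => ?_) (h E hE hEδ)⟩
  rw [dist_eq_norm, dist_eq_norm]
  exact PiLp.norm_apply_le (f (E.2 i).1 - f (E.2 i).2) p

/-- An absolutely continuous function has the increments of any `C¹` function with almost
everywhere the same derivative. -/
theorem AbsolutelyContinuousOnInterval.sub_eq_sub_of_ae_hasDerivAt {f g g' : ℝ → ℝ} {a b : ℝ}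
    (hab : a ≤ b) (hf : AbsolutelyContinuousOnInterval f a b) (hg : ContDiff ℝ 1 g)
    (hg' : ∀ t, HasDerivAt g (g' t) t)
    (h : ∀ᵐ t, t ∈ Set.Ioo a b → HasDerivAt f (g' t) t) : f b - f a = g b - g a := by
  have hgac : AbsolutelyContinuousOnInterval g a b := hg.contDiffOn.absolutelyContinuousOnInterval
  obtain ⟨c, hc⟩ := (hf.sub hgac).const_of_ae_hasDerivAt_zero (by
    have ha : ∀ᵐ t : ℝ, t ≠ a := MeasureTheory.Measure.ae_ne _ a
    have hb : ∀ᵐ t : ℝ, t ≠ b := MeasureTheory.Measure.ae_ne _ b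
    filter_upwards [h, ha, hb] with t ht hta htb htm
    rw [Set.uIcc_of_le hab] at htm
    simpa using (ht ⟨lt_of_le_of_ne htm.1 hta.symm, lt_of_le_of_ne htm.2 htb⟩).sub (hg' t))
  have h1 := hc a Set.left_mem_uIcc
  have h2 := hc b Set.right_mem_uIcc
  simp only [Pi.sub_apply] at h1 h2
  linarith

/-! ### The explicit flow -/

section Coordinates

variable {N : ℕ}

@[simp] theorem NetState.x_mk (x xhat χ : Fin N → ℝ) : (NetState.mk x xhat χ).x = x := by
  ext i; simp [NetState.x, NetState.mk]

@[simp] theorem NetState.xhat_mk (x xhat χ : Fin N → ℝ) :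
    (NetState.mk x xhat χ).xhat = xhat := by
  ext i; simp [NetState.xhat, NetState.mk]

@[simp] theorem NetState.χ_mk (x xhat χ : Fin N → ℝ) : (NetState.mk x xhat χ).χ = χ := by
  ext i; simp [NetState.χ, NetState.mk]

theorem NetState.ext {q q' : NetState N} (hx : q.x = q'.x) (hxhat : q.xhat = q'.xhat)
    (hχ : q.χ = q'.χ) : q = q' := by
  ext ⟨i, k⟩
  fin_cases k
  · exact congrFun hx i
  · exact congrFun hxhat i
  · exact congrFun hχ i

theorem WeightedDigraph.zhat_congr (𝒢 : WeightedDigraph N) {q q' : NetState N}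
    (h : q.xhat = q'.xhat) : 𝒢.zhat q = 𝒢.zhat q' := by
  ext i; simp [WeightedDigraph.zhat, h]

theorem WeightedDigraph.phihat_congr (𝒢 : WeightedDigraph N) {q q' : NetState N}
    (h : q.xhat = q'.xhat) : 𝒢.phihat q = 𝒢.phihat q' := by
  ext i; simp [WeightedDigraph.phihat, h]

/-- The solution of the flow dynamics at time `τ` starting from `q`. -/
noncomputable def WeightedDigraph.flow (𝒢 : WeightedDigraph N) (σ : Fin N → ℝ) (q : NetState N)
    (τ : ℝ) : NetState N :=
  NetState.mk (fun i => q.x i - τ * 𝒢.zhat q i) q.xhat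
    (fun i => q.χ i + τ * 𝒢.clockRate σ q i - τ ^ 2 * 𝒢.zhat q i ^ 2)

variable (𝒢 : WeightedDigraph N) (σ : Fin N → ℝ) (q : NetState N) (τ : ℝ)

theorem flow_x (i : Fin N) : (𝒢.flow σ q τ).x i = q.x i - τ * 𝒢.zhat q i := by
  simp [WeightedDigraph.flow]

@[simp] theorem flow_xhat : (𝒢.flow σ q τ).xhat = q.xhat := by
  simp [WeightedDigraph.flow]

theorem flow_χ (i : Fin N) : (𝒢.flow σ q τ).χ i =
    q.χ i + τ * 𝒢.clockRate σ q i - τ ^ 2 * 𝒢.zhat q i ^ 2 := by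
  simp [WeightedDigraph.flow]

theorem flow_e (i : Fin N) : (𝒢.flow σ q τ).e i = q.e i - τ * 𝒢.zhat q i := by
  simp only [NetState.e, flow_x, flow_xhat]; ring

@[simp] theorem zhat_flow : 𝒢.zhat (𝒢.flow σ q τ) = 𝒢.zhat q :=
  𝒢.zhat_congr (flow_xhat ..)

@[simp] theorem phihat_flow : 𝒢.phihat (𝒢.flow σ q τ) = 𝒢.phihat q :=
  𝒢.phihat_congr (flow_xhat ..)

/-- The term `2 e_i ẑ_i` of the clock rate cancels the derivative `-2 e_i ẑ_i` of `e_i²`. Both the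
minimal time between broadcasts and the bound on broadcast sizes rest on this identity. -/
theorem flow_χ_add_e_sq (i : Fin N) : (𝒢.flow σ q τ).χ i + (𝒢.flow σ q τ).e i ^ 2 =
    q.χ i + q.e i ^ 2 + τ * (σ i * 𝒢.phihat q i) := by
  rw [flow_χ, flow_e, WeightedDigraph.clockRate]; ring

theorem flow_zero : 𝒢.flow σ q 0 = q := by
  apply NetState.ext <;> ext i <;> simp [flow_x, flow_χ]

/-- Reversibility is what lets `flow_eq` relate two points of a layer in either order of time. -/
theorem flow_flow_neg : 𝒢.flow σ (𝒢.flow σ q τ) (-τ) = q := by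
  apply NetState.ext <;> ext i
  · rw [flow_x, flow_x, zhat_flow]; ring
  · simp
  · rw [flow_χ, flow_χ, zhat_flow, WeightedDigraph.clockRate, WeightedDigraph.clockRate, flow_e,
      zhat_flow, phihat_flow]; ring

theorem hasDerivAt_flow (c t : ℝ) : HasDerivAt (fun s => 𝒢.flow σ q (s - c))
    ((closedLoop 𝒢 σ).flowMap (𝒢.flow σ q (t - c))) t := by
  rw [hasDerivAt_euclideanSpace]
  rintro ⟨i, k⟩
  have h1 : HasDerivAt (fun s : ℝ => s - c) 1 t := (hasDerivAt_id t).sub_const c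
  fin_cases k
  · have : HasDerivAt (fun s => (𝒢.flow σ q (s - c)).x i) (-𝒢.zhat q i) t := by
      simp only [flow_x]
      simpa using (h1.mul_const (𝒢.zhat q i)).const_sub (q.x i)
    simpa [closedLoop, NetState.mk, NetState.x] using this
  · have : HasDerivAt (fun s => (𝒢.flow σ q (s - c)).xhat i) 0 t := by
      simp only [flow_xhat]
      exact hasDerivAt_const ..
    simpa [closedLoop, NetState.mk, NetState.xhat] using this
  · have : HasDerivAt (fun s => (𝒢.flow σ q (s - c)).χ i)
        (𝒢.clockRate σ (𝒢.flow σ q (t - c)) i) t := by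
      simp only [flow_χ, WeightedDigraph.clockRate, flow_e, phihat_flow, zhat_flow]
      refine (((h1.mul_const (σ i * 𝒢.phihat q i + 2 * q.e i * 𝒢.zhat q i)).const_add
        (q.χ i)).fun_sub ((h1.fun_pow 2).mul_const (𝒢.zhat q i ^ 2))).congr_deriv ?_
      push_cast
      ring
    simpa [closedLoop, NetState.mk, NetState.χ] using this

theorem contDiff_flow (c : ℝ) : ContDiff ℝ 1 (fun s => 𝒢.flow σ q (s - c)) := by
  rw [contDiff_euclidean]
  rintro ⟨i, k⟩
  fin_cases k
  · have : ContDiff ℝ 1 (fun s => (𝒢.flow σ q (s - c)).x i) := by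
      simp only [flow_x]; fun_prop
    simpa [NetState.x] using this
  · have : ContDiff ℝ 1 (fun s => (𝒢.flow σ q (s - c)).xhat i) := by
      simp only [flow_xhat]; fun_prop
    simpa [NetState.xhat] using this
  · have : ContDiff ℝ 1 (fun s => (𝒢.flow σ q (s - c)).χ i) := by
      simp only [flow_χ]; fun_prop
    simpa [NetState.χ] using this

/-- An absolutely continuous curve obeying the flow dynamics almost everywhere is the explicit
flow. -/
theorem eq_flow_of_ae_hasDerivAt {y : ℝ → NetState N} {a b : ℝ} (hab : a ≤ b)
    (hy : AbsolutelyContinuousOnInterval y a b)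
    (hd : ∀ᵐ t, t ∈ Set.Ioo a b → HasDerivAt y ((closedLoop 𝒢 σ).flowMap (y t)) t) :
    y b = 𝒢.flow σ (y a) (b - a) := by
  have hsub : ∀ c, a ≤ c → c ≤ b → AbsolutelyContinuousOnInterval y a c := fun c h1 h2 =>
    hy.mono (by rw [Set.uIcc_of_le h1, Set.uIcc_of_le hab]; exact Set.Icc_subset_Icc_right h2)
  -- The equations are triangular: `x̂` is constant, which fixes the rate of `x`, and both together
  -- fix the rate of `χ`. The first two are needed at all intermediate times, to identify the
  -- derivatives there.
  have hxhat : ∀ c, a ≤ c → c ≤ b → (y c).xhat = (y a).xhat := by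
    intro c h1 h2
    ext i
    have := ((hsub c h1 h2).euclideanSpace_apply (i, 1)).sub_eq_sub_of_ae_hasDerivAt h1
      (g := fun _ => 0) contDiff_const (fun t => hasDerivAt_const t (0 : ℝ)) (by
        filter_upwards [hd] with t ht htm
        have := (hasDerivAt_euclideanSpace.1 (ht ⟨htm.1, htm.2.trans_le h2⟩)) (i, 1)
        simpa [closedLoop, NetState.mk] using this)
    simp only [NetState.xhat]
    linarith
  have hx : ∀ c, a ≤ c → c ≤ b → ∀ i, (y c).x i = (y a).x i - (c - a) * 𝒢.zhat (y a) i := by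
    intro c h1 h2 i
    have := ((hsub c h1 h2).euclideanSpace_apply (i, 0)).sub_eq_sub_of_ae_hasDerivAt h1
      (g := fun t => t * (-𝒢.zhat (y a) i)) (by fun_prop)
      (fun t => (hasDerivAt_id t).mul_const _) (by
        filter_upwards [hd] with t ht htm
        have := (hasDerivAt_euclideanSpace.1 (ht ⟨htm.1, htm.2.trans_le h2⟩)) (i, 0)
        rw [← 𝒢.zhat_congr (hxhat t htm.1.le (htm.2.le.trans h2))]
        simpa [closedLoop, NetState.mk] using this)
    simp only [NetState.x]
    linarith
  apply NetState.ext
  · ext i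
    rw [flow_x, hx b hab le_rfl]
  · rw [flow_xhat, hxhat b hab le_rfl]
  · ext i
    have := (hy.euclideanSpace_apply (i, 2)).sub_eq_sub_of_ae_hasDerivAt hab
      (g := fun t => (𝒢.flow σ (y a) (t - a)).χ i)
      (g' := fun t => 𝒢.clockRate σ (𝒢.flow σ (y a) (t - a)) i)
      (contDiff_euclidean.1 (contDiff_flow 𝒢 σ (y a) a) (i, 2))
      (fun t => by
        have := hasDerivAt_euclideanSpace.1 (hasDerivAt_flow 𝒢 σ (y a) a t) (i, 2)
        simpa [closedLoop, NetState.mk, NetState.χ] using this) (by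
        filter_upwards [hd] with t ht htm
        have := (hasDerivAt_euclideanSpace.1 (ht htm)) (i, 2)
        have h1 := hxhat t htm.1.le htm.2.le
        have h2 : 𝒢.clockRate σ (y t) i = 𝒢.clockRate σ (𝒢.flow σ (y a) (t - a)) i := by
          simp only [WeightedDigraph.clockRate, flow_e, zhat_flow, phihat_flow,
            𝒢.zhat_congr h1, 𝒢.phihat_congr h1]
          rw [NetState.e, hx t htm.1.le htm.2.le, h1, NetState.e]
          ring
        rw [← h2]
        simpa [closedLoop, NetState.mk] using this)
    simp only [sub_self, flow_zero] at this
    simp only [NetState.χ] at this ⊢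
    linarith

end Coordinates

/-! ### Hybrid time domains: jump times and induction -/

section HybridTimeDomains

theorem le_of_forall_le_succ {t : ℕ → ℝ} {J i j : ℕ} (ht : ∀ k < J, t k ≤ t (k + 1))
    (hij : i ≤ j) (hj : j ≤ J) : t i ≤ t j := by
  induction j, hij using Nat.le_induction with
  | base => exact le_rfl
  | succ k hk ih => exact (ih (by omega)).trans (ht k (by omega))

/-- A set is a hybrid time domain iff it is a chain and the part of it before any of its points is
described by a finite sequence of jump times. -/
theorem isHybridTimeDomain_iff {E : Set (ℝ × ℕ)} :
    IsHybridTimeDomain E ↔ (∀ p ∈ E, ∀ p' ∈ E, p ≤ p' ∨ p' ≤ p) ∧ (∀ p ∈ E, 0 ≤ p.1) ∧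
      ∀ p ∈ E, ∃ t : ℕ → ℝ, t 0 = 0 ∧ (∀ j ≤ p.2, t j ≤ t (j + 1)) ∧ t (p.2 + 1) = p.1 ∧
        ∀ s j, j ≤ p.2 → s ≤ p.1 → ((s, j) ∈ E ↔ s ∈ Set.Icc (t j) (t (j + 1))) := by
  constructor
  · rintro ⟨h, hchain⟩
    have hnn : ∀ p ∈ E, 0 ≤ p.1 := by
      intro p hp
      obtain ⟨J, t, hJ, h0, ht, hE⟩ := h p hp
      have h1 : ((t 0, 0) : ℝ × ℕ) ∈ {p : ℝ × ℕ | p.2 < J ∧ p.1 ∈ Set.Icc (t p.2) (t (p.2 + 1))} :=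
        ⟨hJ, le_rfl, ht 0 hJ⟩
      rw [← hE] at h1
      exact h1.2.1.1.trans h1.2.1.2
    refine ⟨hchain, hnn, fun p hp => ?_⟩
    obtain ⟨J, t, hJ, h0, ht, hE⟩ := h p hp
    have hmem : ∀ q : ℝ × ℕ, (q ∈ E ∧ q.1 ∈ Set.Icc 0 p.1 ∧ q.2 ≤ p.2) ↔
        q.2 < J ∧ q.1 ∈ Set.Icc (t q.2) (t (q.2 + 1)) := by
      intro q
      exact Set.ext_iff.1 hE q
    have hpJ := (hmem p).1 ⟨hp, ⟨hnn p hp, le_rfl⟩, le_rfl⟩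
    -- A further layer would put a point of index `p.2 + 1` into the truncation at `p`.
    have hJ' : J = p.2 + 1 := by
      by_contra hne
      have := (hmem (t (p.2 + 1), p.2 + 1)).2 ⟨by have := hpJ.1; simp only; omega, le_rfl,
        ht _ (by have := hpJ.1; omega)⟩
      have := this.2.2
      simp at this
    subst hJ'
    refine ⟨t, h0, fun j hj => ht j (by omega), ?_, fun s j hj hs => ⟨fun hsE => ?_, fun hst => ?_⟩⟩
    · refine le_antisymm ?_ hpJ.2.2
      exact ((hmem (t (p.2 + 1), p.2)).2 ⟨by simp, ht _ (by omega), le_rfl⟩).2.1.2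
    · exact ((hmem (s, j)).1 ⟨hsE, ⟨hnn _ hsE, hs⟩, hj⟩).2
    · exact ((hmem (s, j)).2 ⟨by simp only; omega, hst⟩).1
  · rintro ⟨hchain, hnn, h⟩
    refine ⟨fun p hp => ?_, hchain⟩
    obtain ⟨t, h0, ht, hT, hE⟩ := h p hp
    refine ⟨p.2 + 1, t, by omega, h0, fun j hj => ht j (by omega), ?_⟩
    ext ⟨s, j⟩
    constructor
    · rintro ⟨hsE, ⟨-, hs⟩, hj⟩
      exact ⟨Nat.lt_succ_of_le hj, (hE s j hj hs).1 hsE⟩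
    · rintro ⟨hj, hst⟩
      have hj' : j ≤ p.2 := Nat.le_of_lt_succ hj
      have hs : s ≤ p.1 := by
        rw [← hT]
        exact hst.2.trans (le_of_forall_le_succ (J := p.2 + 1) (fun k hk => ht k (by omega))
          (by omega) le_rfl)
      have := (hE s j hj' hs).2 hst
      exact ⟨this, ⟨hnn _ this, hs⟩, hj'⟩

variable {E : Set (ℝ × ℕ)}

theorem IsHybridTimeDomain.mem_of_mem_Icc (hE : IsHybridTimeDomain E) {a b s : ℝ} {j : ℕ}
    (ha : (a, j) ∈ E) (hb : (b, j) ∈ E) (hs : s ∈ Set.Icc a b) : (s, j) ∈ E := by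
  obtain ⟨t, -, -, hT, h⟩ := (isHybridTimeDomain_iff.1 hE).2.2 _ hb
  have h1 := (h a j le_rfl (hs.1.trans hs.2)).1 ha
  exact (h s j le_rfl hs.2).2 ⟨h1.1.trans hs.1, hs.2.trans hT.ge⟩

theorem IsHybridTimeDomain.le_of_lt (hE : IsHybridTimeDomain E) {a b : ℝ} {i j : ℕ}
    (ha : (a, i) ∈ E) (hb : (b, j) ∈ E) (hij : i < j) : a ≤ b := by
  rcases (isHybridTimeDomain_iff.1 hE).1 _ ha _ hb with h | h
  · exact h.1
  · exact absurd h.2 (by simpa using hij)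

/-- Induction along a hybrid time domain, starting from one of its points. -/
theorem IsHybridTimeDomain.induction (hE : IsHybridTimeDomain E) {P : ℝ → ℕ → Prop} {s : ℝ}
    {i : ℕ} (hs : (s, i) ∈ E) (h0 : P s i)
    (hflow : ∀ a b j, (a, j) ∈ E → (b, j) ∈ E → s ≤ a → i ≤ j → a ≤ b → P a j → P b j)
    (hjump : ∀ t j, (t, j) ∈ E → (t, j + 1) ∈ E → s ≤ t → i ≤ j → P t j → P t (j + 1))
    {T : ℝ} {J : ℕ} (hT : (T, J) ∈ E) (hsT : s ≤ T) (hiJ : i ≤ J) : P T J := by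
  obtain ⟨t, -, ht, htT, h⟩ := (isHybridTimeDomain_iff.1 hE).2.2 _ hT
  simp only at ht htT h
  have hmono : ∀ {k l : ℕ}, k ≤ l → l ≤ J + 1 → t k ≤ t l := fun hkl hl =>
    le_of_forall_le_succ (J := J + 1) (fun k hk => ht k (by omega)) hkl hl
  have hsi := (h s i hiJ hsT).1 hs
  have hr : ∀ j ≤ J, (t (j + 1), j) ∈ E := fun j hj =>
    (h _ _ hj (htT ▸ hmono (by omega) le_rfl)).2 ⟨ht j hj, le_rfl⟩
  have hl : ∀ j ≤ J, (t j, j) ∈ E := fun j hj =>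
    (h _ _ hj (htT ▸ hmono (by omega) le_rfl)).2 ⟨le_rfl, ht j hj⟩
  -- Layer `i` is entered at `s`; every later layer is entered by a jump at its left end and flowed
  -- through to its right end.
  have key : ∀ j, i ≤ j → j ≤ J → P (t (j + 1)) j := by
    intro j hij
    induction j, hij using Nat.le_induction with
    | base => exact fun hj => hflow s _ i hs (hr i hj) le_rfl le_rfl hsi.2 h0
    | succ k hk ih =>
      intro hkJ
      have hsk : s ≤ t (k + 1) := hsi.2.trans (hmono (by omega) (by omega))
      exact hflow _ _ _ (hl _ hkJ) (hr _ hkJ) hsk (by omega) (ht _ hkJ)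
        (hjump _ _ (hr k (by omega)) (hl _ hkJ) hsk hk (ih (by omega)))
  exact htT ▸ key J hiJ le_rfl

/-- Every time up to that of a point of a hybrid time domain is attained after any earlier
point. -/
theorem IsHybridTimeDomain.exists_mem (hE : IsHybridTimeDomain E) {s T r : ℝ} {i J : ℕ}
    (hs : (s, i) ∈ E) (hT : (T, J) ∈ E) (hiJ : i ≤ J) (hsr : s ≤ r) (hrT : r ≤ T) :
    ∃ j, i ≤ j ∧ (r, j) ∈ E := by
  refine hE.induction (P := fun b _ => r ≤ b → ∃ j, i ≤ j ∧ (r, j) ∈ E) hs ?_ ?_ ?_ hT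
    (hsr.trans hrT) hiJ hrT
  · intro h
    exact ⟨i, le_rfl, le_antisymm hsr h ▸ hs⟩
  · intro a b j ha hb _ hij _ ih hrb
    rcases le_total r a with h | h
    · exact ih h
    · exact ⟨j, hij, hE.mem_of_mem_Icc ha hb ⟨h, hrb⟩⟩
  · intro t j _ _ _ _ ih
    exact ih

end HybridTimeDomains

/-! ### Broadcasts and solutions of the closed loop -/

section Solutions

variable {N : ℕ} {𝒢 : WeightedDigraph N} {σ : Fin N → ℝ}

theorem broadcast_x (i : Fin N) (q : NetState N) : (broadcast i q).x = q.x := by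
  simp [broadcast]

theorem broadcast_χ (i : Fin N) (q : NetState N) : (broadcast i q).χ = q.χ := by
  simp [broadcast]

theorem broadcast_xhat_self (i : Fin N) (q : NetState N) : (broadcast i q).xhat i = q.x i := by
  simp [broadcast]

theorem broadcast_xhat_of_ne {i k : Fin N} (h : k ≠ i) (q : NetState N) :
    (broadcast i q).xhat k = q.xhat k := by
  simp [broadcast, h]

theorem broadcast_e_self (i : Fin N) (q : NetState N) : (broadcast i q).e i = 0 := by
  simp [NetState.e, broadcast_x, broadcast_xhat_self]

theorem broadcast_e_of_ne {i k : Fin N} (h : k ≠ i) (q : NetState N) :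
    (broadcast i q).e k = q.e k := by
  simp [NetState.e, broadcast_x, broadcast_xhat_of_ne h]

namespace HybridSystem.IsSolution

variable {φ : HybridArc (NetState N)}

theorem flow_eq (hφ : (closedLoop 𝒢 σ).IsSolution φ) {a b : ℝ} {j : ℕ} (ha : (a, j) ∈ φ.dom)
    (hb : (b, j) ∈ φ.dom) : φ.toFun b j = 𝒢.flow σ (φ.toFun a j) (b - a) := by
  have key : ∀ {a b : ℝ}, (a, j) ∈ φ.dom → (b, j) ∈ φ.dom → a ≤ b →
      φ.toFun b j = 𝒢.flow σ (φ.toFun a j) (b - a) := by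
    intro a b ha hb hab
    have hsub : Set.Icc a b ⊆ φ.interval j := fun s hs =>
      φ.isHybridTimeDomain.mem_of_mem_Icc ha hb hs
    refine eq_flow_of_ae_hasDerivAt 𝒢 σ hab (φ.locallyAC j a b hab hsub) ?_
    filter_upwards [hφ.flow_deriv j] with t ht htm
    exact ht (interior_maximal (Set.Ioo_subset_Icc_self.trans hsub) isOpen_Ioo htm)
  rcases le_total a b with hab | hab
  · exact key ha hb hab
  · rw [key hb ha hab, show b - a = -(a - b) by ring, flow_flow_neg]

/-- A solution is only required to lie in the flow set in the interior of each interval; right end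
points follow by continuity of the explicit flow, and jumps leave `χ` alone. -/
theorem χ_nonneg (hφ : (closedLoop 𝒢 σ).IsSolution φ) (hinit : IsInitialized (φ.toFun 0 0))
    {t : ℝ} {j : ℕ} (h : (t, j) ∈ φ.dom) (i : Fin N) : 0 ≤ (φ.toFun t j).χ i := by
  refine φ.isHybridTimeDomain.induction (P := fun t j => 0 ≤ (φ.toFun t j).χ i) hφ.zero_mem
    (hinit i).2.ge ?_ ?_ h ((isHybridTimeDomain_iff.1 φ.isHybridTimeDomain).2.1 _ h)
    (Nat.zero_le _)
  · intro a b j ha hb _ _ hab hχ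
    rcases hab.eq_or_lt with rfl | hab
    · exact hχ
    have hc : Continuous fun s => (𝒢.flow σ (φ.toFun a j) (s - a)).χ i := by
      simp only [flow_χ]; fun_prop
    have hcl : IsClosed {s | 0 ≤ (𝒢.flow σ (φ.toFun a j) (s - a)).χ i} :=
      isClosed_le continuous_const hc
    have hIoo : Set.Ioo a b ⊆ {s | 0 ≤ (𝒢.flow σ (φ.toFun a j) (s - a)).χ i} := by
      intro s hs
      have hsub : Set.Icc a b ⊆ φ.interval j := fun s hs =>
        φ.isHybridTimeDomain.mem_of_mem_Icc ha hb hs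
      have := hφ.flow_mem j s
        (interior_maximal (Set.Ioo_subset_Icc_self.trans hsub) isOpen_Ioo hs)
      rw [hφ.flow_eq ha (hsub (Set.Ioo_subset_Icc_self hs))] at this
      exact this i
    have := hcl.closure_subset_iff.2 hIoo
    rw [closure_Ioo hab.ne] at this
    have hb' := this (Set.right_mem_Icc.2 hab.le)
    rw [Set.mem_ofPred_eq, ← hφ.flow_eq ha hb] at hb'
    exact hb'
  · intro t j h1 h2 _ _ hχ
    obtain ⟨k, -, hk⟩ := (hφ.jump t j h1 h2).2
    rw [hk, broadcast_χ]
    exact hχ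

/-- Induction along a trajectory of the closed loop. -/
theorem induction (hφ : (closedLoop 𝒢 σ).IsSolution φ) (hinit : IsInitialized (φ.toFun 0 0))
    {P : ℝ → ℕ → NetState N → Prop} {s : ℝ} {i : ℕ} (hs : (s, i) ∈ φ.dom)
    (h0 : P s i (φ.toFun s i))
    (hflow : ∀ a τ j q, s ≤ a → 0 ≤ τ → (∀ k, 0 ≤ q.χ k) → P a j q →
      P (a + τ) j (𝒢.flow σ q τ))
    (hjump : ∀ a j q k, s ≤ a → (∀ l, 0 ≤ q.χ l) → q ∈ triggerSet k → P a j q →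
      P a (j + 1) (broadcast k q))
    {t : ℝ} {j : ℕ} (ht : (t, j) ∈ φ.dom) (hst : s ≤ t) (hij : i ≤ j) :
    P t j (φ.toFun t j) := by
  refine φ.isHybridTimeDomain.induction (P := fun t j => P t j (φ.toFun t j)) hs h0 ?_ ?_ ht hst hij
  · intro a b j ha hb hsa _ hab hP
    have := hflow a (b - a) j _ hsa (sub_nonneg.2 hab) (fun k => hφ.χ_nonneg hinit ha k) hP
    rwa [← hφ.flow_eq ha hb, add_sub_cancel] at this
  · intro t j h1 h2 hst _ hP
    obtain ⟨k, hk, hk'⟩ := (hφ.jump t j h1 h2).2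
    rw [hk']
    exact hjump t j _ k hst (fun k => hφ.χ_nonneg hinit h1 k) hk hP

end HybridSystem.IsSolution

/-! ### Minimal time between broadcasts -/

/-- The out-degree of a vertex. -/
noncomputable def WeightedDigraph.outDegree (𝒢 : WeightedDigraph N) (i : Fin N) : ℝ := ∑ j, 𝒢.w i j

theorem WeightedDigraph.outDegree_nonneg (𝒢 : WeightedDigraph N) (i : Fin N) :
    0 ≤ 𝒢.outDegree i := Finset.sum_nonneg fun j _ => 𝒢.nonneg i j

theorem WeightedDigraph.phihat_nonneg (𝒢 : WeightedDigraph N) (q : NetState N) (i : Fin N) :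
    0 ≤ 𝒢.phihat q i :=
  Finset.sum_nonneg fun j _ => mul_nonneg (𝒢.nonneg i j) (sq_nonneg _)

/-- Cauchy–Schwarz for the weights `w i j`. -/
theorem WeightedDigraph.zhat_sq_le (𝒢 : WeightedDigraph N) (q : NetState N) (i : Fin N) :
    𝒢.zhat q i ^ 2 ≤ 𝒢.outDegree i * 𝒢.phihat q i :=
  Finset.sum_sq_le_sum_mul_sum_of_sq_le_mul _ (fun j _ => 𝒢.nonneg i j)
    (fun j _ => mul_nonneg (𝒢.nonneg i j) (sq_nonneg _)) (fun j _ => le_of_eq (by ring))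

/-- The bound on the error of agent `i` in terms of the time elapsed since a reset at time `s`. -/
def ErrorBound (𝒢 : WeightedDigraph N) (σ : Fin N → ℝ) (i : Fin N) (s t : ℝ)
    (q : NetState N) : Prop :=
  σ i * q.e i ^ 2 ≤ (t - s) * 𝒢.outDegree i * (q.χ i + q.e i ^ 2)

theorem ErrorBound.of_e_eq_zero {i : Fin N} {s t : ℝ} {q : NetState N} (hst : s ≤ t)
    (hχ : 0 ≤ q.χ i) (he : q.e i = 0) : ErrorBound 𝒢 σ i s t q := by
  have := mul_nonneg (mul_nonneg (sub_nonneg.2 hst) (𝒢.outDegree_nonneg i)) hχ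
  simpa [ErrorBound, he] using this

theorem ErrorBound.broadcast_of_ne {i k : Fin N} (hik : i ≠ k) {s t : ℝ} {q : NetState N}
    (h : ErrorBound 𝒢 σ i s t q) : ErrorBound 𝒢 σ i s t (broadcast k q) := by
  simpa [ErrorBound, broadcast_e_of_ne hik, broadcast_χ] using h

/-- Both sides are polynomials in `τ`. The constant terms compare by hypothesis and the `τ²` terms
by `zhat_sq_le`, leaving the sign of the linear coefficient, which is `key`. -/
theorem ErrorBound.flow {i : Fin N} (hσ : 0 < σ i) {s a τ : ℝ} (hsa : s ≤ a) (hτ : 0 ≤ τ)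
    {q : NetState N} (hχ : 0 ≤ q.χ i) (h : ErrorBound 𝒢 σ i s a q) :
    ErrorBound 𝒢 σ i s (a + τ) (𝒢.flow σ q τ) := by
  unfold ErrorBound at *
  rw [flow_χ_add_e_sq, flow_e]
  have hz := 𝒢.zhat_sq_le q i
  have hd := 𝒢.outDegree_nonneg i
  have hF := 𝒢.phihat_nonneg q i
  have hS : 0 ≤ q.χ i + q.e i ^ 2 := add_nonneg hχ (sq_nonneg _)
  generalize q.χ i + q.e i ^ 2 = S at *
  generalize 𝒢.zhat q i = Z at *
  generalize 𝒢.outDegree i = d at *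
  generalize 𝒢.phihat q i = F at *
  generalize q.e i = e at *
  generalize σ i = c at *
  obtain ⟨u, rfl⟩ : ∃ u, a = s + u := ⟨a - s, by ring⟩
  have hu : 0 ≤ u := by linarith
  have h' : c * e ^ 2 ≤ u * d * S := by simpa using h
  have key : 0 ≤ u * c * (d * F) + d * S + 2 * c * e * Z := by
    have h1 : u * c * Z ^ 2 ≤ u * c * (d * F) := mul_le_mul_of_nonneg_left hz (by positivity)
    -- For `u = 0` the hypothesis forces `e = 0`. For `u > 0`, `u` times the coefficient is at least
    -- the square `c (u Z + e)²`.
    rcases hu.eq_or_lt with rfl | hu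
    · have : e = 0 := by
        have : c * e ^ 2 ≤ 0 := by simpa using h'
        have h2 : e ^ 2 ≤ 0 := by
          by_contra hcon
          have := mul_pos hσ (not_le.1 hcon)
          linarith
        exact pow_eq_zero_iff (two_ne_zero) |>.1 (le_antisymm h2 (sq_nonneg _))
      rw [this]
      have := mul_nonneg hd hS
      nlinarith
    · refine le_of_mul_le_mul_left ?_ hu
      have h2 : 0 ≤ c * (u * Z + e) ^ 2 := by positivity
      nlinarith
  have h3 : c * τ ^ 2 * Z ^ 2 ≤ c * τ ^ 2 * (d * F) := mul_le_mul_of_nonneg_left hz (by positivity)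
  have h4 := mul_nonneg hτ key
  nlinarith

theorem ErrorBound.le_of_mem_triggerSet {i : Fin N} {s t : ℝ} {q : NetState N}
    (h : ErrorBound 𝒢 σ i s t q) (hq : q ∈ triggerSet i) : σ i ≤ (t - s) * 𝒢.outDegree i := by
  have he : 0 < q.e i ^ 2 := by
    have : q.e i ≠ 0 := sub_ne_zero.2 hq.2.symm
    positivity
  unfold ErrorBound at h
  rw [hq.1, zero_add] at h
  exact le_of_mul_le_mul_right h he

/-- The number of jumps up to time `t` is at most `t ∑ i, d_i / σ_i`. -/
theorem HybridSystem.IsSolution.jumps_le (hσ : ∀ i, 0 < σ i) {φ : HybridArc (NetState N)}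
    (hφ : (closedLoop 𝒢 σ).IsSolution φ) (hinit : IsInitialized (φ.toFun 0 0)) {t : ℝ} {j : ℕ}
    (h : (t, j) ∈ φ.dom) : (j : ℝ) ≤ t * ∑ i, 𝒢.outDegree i / σ i := by
  -- `n i` counts the broadcasts of agent `i` and `s i` is the time of its last reset. The initial
  -- time counts as a reset because `e_i = 0` there.
  have := hφ.induction hinit (P := fun t j q => ∃ (n : Fin N → ℕ) (s : Fin N → ℝ),
      j = ∑ i, n i ∧ ∀ i, s i ≤ t ∧ n i * σ i ≤ s i * 𝒢.outDegree i ∧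
        ErrorBound 𝒢 σ i (s i) t q) hφ.zero_mem
    ⟨fun _ => 0, fun _ => 0, by simp, fun i => ⟨le_rfl, by simp,
      ErrorBound.of_e_eq_zero le_rfl (hinit i).2.ge (by simp [NetState.e, (hinit i).1])⟩⟩
    (by
      rintro a τ j q _ hτ hχ ⟨n, s, hn, hs⟩
      exact ⟨n, s, hn, fun i => ⟨by linarith [(hs i).1], (hs i).2.1,
        (hs i).2.2.flow (hσ i) (hs i).1 hτ (hχ i)⟩⟩)
    (by
      rintro a j q k _ hχ hq ⟨n, s, hn, hs⟩
      refine ⟨n + Pi.single k 1, Function.update s k a, by simp [Finset.sum_add_distrib, hn],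
        fun i => ?_⟩
      by_cases hik : i = k
      · subst hik
        have h1 := (hs i).2.2.le_of_mem_triggerSet hq
        have h2 := (hs i).2.1
        refine ⟨by simp, ?_, ?_⟩
        · simp only [Pi.add_apply, Pi.single_eq_same, Function.update_self]
          push_cast
          linarith
        · rw [Function.update_self]
          exact ErrorBound.of_e_eq_zero le_rfl (by rw [broadcast_χ]; exact hχ i)
            (broadcast_e_self i q)
      · simp only [Function.update_of_ne hik, Pi.add_apply, Pi.single_eq_of_ne hik, add_zero]
        exact ⟨(hs i).1, (hs i).2.1, (hs i).2.2.broadcast_of_ne hik⟩)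
    h ((isHybridTimeDomain_iff.1 φ.isHybridTimeDomain).2.1 _ h) (Nat.zero_le _)
  obtain ⟨n, s, rfl, hs⟩ := this
  rw [Nat.cast_sum, Finset.mul_sum]
  refine Finset.sum_le_sum fun i _ => ?_
  rw [← mul_div_assoc, le_div_iff₀ (hσ i)]
  exact (hs i).2.1.trans (mul_le_mul_of_nonneg_right (hs i).1 (𝒢.outDegree_nonneg i))

end Solutions

/-! ### Extending solutions; existence for all times -/

section Extension

variable {E : Set (ℝ × ℕ)}

/-- The last interval of a hybrid time domain can be prolonged. -/
theorem IsHybridTimeDomain.union_Icc (hE : IsHybridTimeDomain E) {a c : ℝ} {J : ℕ}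
    (ha : (a, J) ∈ E) (hJ : ∀ p ∈ E, p.2 ≤ J) (hc : ∀ t, (t, J) ∈ E → t ≤ c) :
    IsHybridTimeDomain (E ∪ {p | p.1 ∈ Set.Icc a c ∧ p.2 = J}) := by
  have hE' := hE
  rw [isHybridTimeDomain_iff] at hE' ⊢
  obtain ⟨hchain, hnn, hpre⟩ := hE'
  have hcross : ∀ p ∈ E, ∀ r ∈ Set.Icc a c, p ≤ (r, J) ∨ (r, J) ≤ p := by
    rintro ⟨s, j⟩ hp r hr
    rcases (hJ _ hp).lt_or_eq with h | h
    · exact Or.inl ⟨(hE.le_of_lt hp ha h).trans hr.1, h.le⟩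
    · simp only at h
      subst h
      rcases le_total s r with h | h
      · exact Or.inl ⟨h, le_rfl⟩
      · exact Or.inr ⟨h, le_rfl⟩
  have hnew : ∀ r ∈ Set.Icc a c, ∃ t : ℕ → ℝ, t 0 = 0 ∧ (∀ j ≤ J, t j ≤ t (j + 1)) ∧
      t (J + 1) = r ∧ ∀ s j, j ≤ J → s ≤ r →
        ((s, j) ∈ E ∪ {p | p.1 ∈ Set.Icc a c ∧ p.2 = J} ↔ s ∈ Set.Icc (t j) (t (j + 1))) := by
    intro r hr
    obtain ⟨t, h0, ht, hT, h⟩ := hpre _ ha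
    simp only at ht hT h
    -- Moving the end of the last layer from `a` to `r` changes only the entry `J + 1` of the
    -- sequence of times.
    have hu : ∀ j ≤ J, Function.update t (J + 1) r j = t j := fun j hj =>
      Function.update_of_ne (by omega) ..
    refine ⟨Function.update t (J + 1) r, by rw [hu 0 (Nat.zero_le _), h0], fun j hj => ?_, by simp,
      fun s j hj hs => ?_⟩
    · rw [hu j hj]
      rcases hj.lt_or_eq with hj' | rfl
      · rw [hu _ hj']
        exact ht j hj
      · rw [Function.update_self]
        exact (ht j le_rfl).trans (hT.trans_le hr.1)
    · rw [hu j hj]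
      rcases hj.lt_or_eq with hj' | rfl
      · rw [hu _ hj']
        have hsa : s ∈ Set.Icc (t j) (t (j + 1)) → s ≤ a := fun hs => hs.2.trans <| hT ▸
          le_of_forall_le_succ (J := J + 1) (fun k hk => ht k (by omega)) (by omega) le_rfl
        constructor
        · rintro (hsE | ⟨-, hsJ⟩)
          · exact (h s j hj (hE.le_of_lt hsE ha hj')).1 hsE
          · simp only at hsJ
            omega
        · intro hst
          exact Or.inl ((h s j hj (hsa hst)).2 hst)
      · rw [Function.update_self]
        constructor
        · rintro (hsE | ⟨hsa, -⟩)
          · rcases le_total s a with hsa | hsa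
            · exact ⟨((h s j le_rfl hsa).1 hsE).1, hs⟩
            · exact ⟨(ht j le_rfl).trans (hT.trans_le hsa), hs⟩
          · exact ⟨(ht j le_rfl).trans (hT.trans_le hsa.1), hs⟩
        · intro hst
          rcases le_total s a with hsa | hsa
          · exact Or.inl ((h s j le_rfl hsa).2 ⟨hst.1, hsa.trans hT.ge⟩)
          · exact Or.inr ⟨⟨hsa, hs.trans hr.2⟩, rfl⟩
  refine ⟨?_, ?_, ?_⟩
  · rintro p (hp | ⟨hp, hp2⟩) p' (hp' | ⟨hp', hp2'⟩)
    · exact hchain p hp p' hp'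
    · have := hcross p hp _ hp'
      rwa [← hp2'] at this
    · have := hcross p' hp' _ hp
      rwa [← hp2, or_comm] at this
    · rcases le_total p.1 p'.1 with h | h
      · exact Or.inl ⟨h, (hp2.trans hp2'.symm).le⟩
      · exact Or.inr ⟨h, (hp2'.trans hp2.symm).le⟩
  · rintro p (hp | ⟨hp, -⟩)
    · exact hnn p hp
    · exact (hnn _ ha).trans hp.1
  · rintro ⟨r, k⟩ hp
    by_cases hnew' : a ≤ r ∧ k = J
    · obtain ⟨har, rfl⟩ := hnew'
      exact hnew r ⟨har, hp.elim (hc r) fun h => h.1.2⟩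
    · have hpE : (r, k) ∈ E := hp.elim id fun h => absurd ⟨h.1.1, h.2⟩ hnew'
      obtain ⟨t, h0, ht, hT, h⟩ := hpre _ hpE
      refine ⟨t, h0, ht, hT, fun s j hj hs => ?_⟩
      rw [← h s j hj hs]
      refine ⟨fun hsE => hsE.elim id ?_, Or.inl⟩
      rintro ⟨hsa, hjJ⟩
      simp only at hsa hjJ hj hs
      exact absurd ⟨hsa.1.trans hs, le_antisymm (hJ _ hpE) (hjJ ▸ hj)⟩ hnew'

/-- A jump can be appended at the last point of a hybrid time domain. -/
theorem IsHybridTimeDomain.insert_jump (hE : IsHybridTimeDomain E) {b : ℝ} {J : ℕ}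
    (hb : (b, J) ∈ E) (hmax : ∀ p ∈ E, p ≤ (b, J)) :
    IsHybridTimeDomain (insert (b, J + 1) E) := by
  rw [isHybridTimeDomain_iff] at hE ⊢
  obtain ⟨hchain, hnn, hpre⟩ := hE
  have hle : ∀ p ∈ E, p ≤ (b, J + 1) := fun p hp => (hmax p hp).trans ⟨le_rfl, Nat.le_succ J⟩
  refine ⟨?_, ?_, ?_⟩
  · rintro p (rfl | hp) p' (rfl | hp')
    · exact Or.inl le_rfl
    · exact Or.inr (hle _ hp')
    · exact Or.inl (hle _ hp)
    · exact hchain p hp p' hp'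
  · rintro p (rfl | hp)
    · exact hnn (b, J) hb
    · exact hnn p hp
  · rintro p (rfl | hp)
    · obtain ⟨t, h0, ht, hT, h⟩ := hpre _ hb
      simp only at ht hT h ⊢
      -- With entry `J + 2` set to `b`, equal to entry `J + 1`, the new layer is the single point
      -- `b`.
      have hu : ∀ j ≤ J + 1, Function.update t (J + 2) b j = t j := fun j hj =>
        Function.update_of_ne (by omega) ..
      refine ⟨Function.update t (J + 2) b, by rw [hu 0 (Nat.zero_le _), h0], fun j hj => ?_,
        by simp, fun s j hj hs => ?_⟩
      · rw [hu j hj]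
        rcases hj.lt_or_eq with hj' | rfl
        · rw [hu _ hj']
          exact ht j (by omega)
        · rw [Function.update_self]
          exact hT.le
      · rw [hu j hj]
        rcases hj.lt_or_eq with hj' | rfl
        · rw [hu _ hj', ← h s j (by omega) hs]
          refine ⟨fun hsE => hsE.elim (fun h => ?_) id, Or.inr⟩
          have := congrArg Prod.snd h
          simp only at this
          omega
        · rw [Function.update_self, hT]
          constructor
          · rintro (h | h)
            · exact ⟨(congrArg Prod.fst h).ge, hs⟩
            · have := (hmax _ h).2
              simp at this
          · intro hsb
            exact Or.inl (by rw [le_antisymm hs hsb.1])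
    · obtain ⟨t, h0, ht, hT, h⟩ := hpre _ hp
      refine ⟨t, h0, ht, hT, fun s j hj hs => ?_⟩
      rw [← h s j hj hs]
      refine ⟨fun hsE => hsE.elim (fun h => ?_) id, Or.inr⟩
      have h1 := congrArg Prod.snd h
      have h2 := (hmax _ hp).2
      simp only at h1 h2
      omega

variable {N : ℕ} {𝒢 : WeightedDigraph N} {σ : Fin N → ℝ} {φ : HybridArc (NetState N)}

theorem HybridSystem.IsSolution.exists_flow_extension (hφ : (closedLoop 𝒢 σ).IsSolution φ)
    (hinit : IsInitialized (φ.toFun 0 0)) {a c : ℝ} {J : ℕ}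
    (ha : (a, J) ∈ φ.dom) (hac : a ≤ c) (hJ : ∀ p ∈ φ.dom, p.2 ≤ J)
    (hc : ∀ t, (t, J) ∈ φ.dom → t ≤ c)
    (hχ : ∀ t ∈ Set.Ioo a c, ∀ i, 0 ≤ (𝒢.flow σ (φ.toFun a J) (t - a)).χ i) :
    ∃ ψ : HybridArc (NetState N), (closedLoop 𝒢 σ).IsSolution ψ ∧
      ψ.dom = φ.dom ∪ {p | p.1 ∈ Set.Icc a c ∧ p.2 = J} ∧
      ∀ (t : ℝ) (j : ℕ), (t, j) ∈ φ.dom → ψ.toFun t j = φ.toFun t j := by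
  classical
  -- All of layer `J` is redefined by the flow through `a`; times before `a` agree as well, since
  -- `flow_eq` works backwards.
  have hagree : ∀ (t : ℝ) (j : ℕ), (t, j) ∈ φ.dom →
      (if j = J then 𝒢.flow σ (φ.toFun a J) (t - a) else φ.toFun t j) = φ.toFun t j := by
    intro t j h
    split_ifs with hj
    · subst hj
      exact (hφ.flow_eq ha h).symm
    · rfl
  have hdom : ∀ {j}, j ≠ J → ∀ t,
      (t, j) ∈ φ.dom ∪ {p : ℝ × ℕ | p.1 ∈ Set.Icc a c ∧ p.2 = J} → (t, j) ∈ φ.dom :=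
    fun hj t h => h.elim id fun h => absurd h.2 hj
  let ψ : HybridArc (NetState N) :=
    { dom := φ.dom ∪ {p | p.1 ∈ Set.Icc a c ∧ p.2 = J}
      toFun := fun t j => if j = J then 𝒢.flow σ (φ.toFun a J) (t - a) else φ.toFun t j
      isHybridTimeDomain := φ.isHybridTimeDomain.union_Icc ha hJ hc
      locallyAC := by
        intro j u v huv hsub
        by_cases hj : j = J
        · simp only [hj, if_true]
          exact (contDiff_flow 𝒢 σ _ a).contDiffOn.absolutelyContinuousOnInterval
        · simp only [hj, if_false]
          exact φ.locallyAC j u v huv fun t ht => hdom hj t (hsub ht) }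
  have hint : ∀ {j}, j ≠ J → interior (ψ.interval j) ⊆ interior (φ.interval j) := fun hj =>
    interior_mono fun t ht => hdom hj t ht
  refine ⟨ψ, ⟨Or.inl hφ.zero_mem, ?_, ?_, ?_, ?_⟩, rfl, hagree⟩
  · have := hφ.init
    rwa [← hagree 0 0 hφ.zero_mem] at this
  · intro j t ht
    by_cases hmem : (t, j) ∈ φ.dom
    · change (if j = J then _ else _) ∈ _
      rw [hagree t j hmem]
      exact fun i => hφ.χ_nonneg hinit hmem i
    · have htψ : t ∈ ψ.interval j := interior_subset ht
      obtain ⟨hta, hj⟩ := htψ.resolve_left hmem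
      simp only at hta hj
      subst hj
      -- A new interior time is neither `a`, which is in the old domain, nor `c`, which bounds the
      -- layer. Hence `hχ` on the open interval suffices.
      have hat : t ≠ a := by rintro rfl; exact hmem ha
      have htc : t ≠ c := by
        rintro rfl
        have hle : ψ.interval j ⊆ Set.Iic t := fun s hs => hs.elim (hc s) fun h => h.1.2
        have := interior_mono hle ht
        rw [interior_Iic] at this
        exact (lt_irrefl t) this
      change (if j = j then _ else _) ∈ _
      rw [if_pos rfl]
      exact hχ t ⟨lt_of_le_of_ne hta.1 hat.symm, lt_of_le_of_ne hta.2 htc⟩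
  · intro j
    by_cases hj : j = J
    · refine Filter.Eventually.of_forall fun t _ => ?_
      simp only [ψ, hj, if_true]
      exact hasDerivAt_flow 𝒢 σ _ a t
    · filter_upwards [hφ.flow_deriv j] with t ht htm
      simp only [ψ, hj, if_false]
      exact ht (hint hj htm)
  · intro t j h1 h2
    have hj : j ≠ J := by
      rintro rfl
      rcases h2 with h2 | h2
      · have := hJ _ h2
        simp at this
      · have := h2.2
        simp at this
    have h1' := hdom hj t h1
    have h2' : (t, j + 1) ∈ φ.dom := by
      rcases h2 with h2 | ⟨h2, h3⟩
      · exact h2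
      · have h4 := φ.isHybridTimeDomain.le_of_lt h1' ha (lt_of_le_of_ne (hJ _ h1') hj)
        simp only at h2 h3
        rw [h3, le_antisymm h4 h2.1]
        exact ha
    change (if j = J then _ else _) ∈ _ ∧ (if j + 1 = J then _ else _) ∈ HybridSystem.jumpMap _
      (if j = J then _ else _)
    rw [hagree t j h1', hagree t _ h2']
    exact hφ.jump t j h1' h2'

theorem HybridSystem.IsSolution.exists_jump_extension (hφ : (closedLoop 𝒢 σ).IsSolution φ)
    {b : ℝ} {J : ℕ} (hb : (b, J) ∈ φ.dom) (hmax : ∀ p ∈ φ.dom, p ≤ (b, J)) {i : Fin N}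
    (hi : φ.toFun b J ∈ triggerSet i) :
    ∃ ψ : HybridArc (NetState N), (closedLoop 𝒢 σ).IsSolution ψ ∧
      ψ.dom = insert (b, J + 1) φ.dom ∧
      ∀ (t : ℝ) (j : ℕ), (t, j) ∈ φ.dom → ψ.toFun t j = φ.toFun t j := by
  classical
  have hnot : ∀ t, (t, J + 1) ∉ φ.dom := fun t h => by
    have := (hmax _ h).2
    simp at this
  have hne : ∀ {t j}, (t, j) ∈ φ.dom → j ≠ J + 1 := fun h hj => hnot _ (hj ▸ h)
  have hagree : ∀ (t : ℝ) (j : ℕ), (t, j) ∈ φ.dom →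
      (if j = J + 1 then broadcast i (φ.toFun b J) else φ.toFun t j) = φ.toFun t j :=
    fun t j h => if_neg (hne h)
  have hdom : ∀ {j}, j ≠ J + 1 → ∀ t, (t, j) ∈ insert (b, J + 1) φ.dom → (t, j) ∈ φ.dom :=
    fun hj t h => h.elim (fun h => absurd (congrArg Prod.snd h) hj) id
  have heq : ∀ t, (t, J + 1) ∈ insert (b, J + 1) φ.dom → t = b :=
    fun t h => h.elim (fun h => congrArg Prod.fst h) fun h => absurd h (hnot t)
  let ψ : HybridArc (NetState N) :=
    { dom := insert (b, J + 1) φ.dom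
      toFun := fun t j => if j = J + 1 then broadcast i (φ.toFun b J) else φ.toFun t j
      isHybridTimeDomain := φ.isHybridTimeDomain.insert_jump hb hmax
      locallyAC := by
        intro j u v huv hsub
        by_cases hj : j = J + 1
        · simp only [hj, if_true]
          exact contDiffOn_const.absolutelyContinuousOnInterval
        · simp only [hj, if_false]
          exact φ.locallyAC j u v huv fun t ht => hdom hj t (hsub ht) }
  -- The new layer has empty interior, so it imposes no flow condition.
  have hint : ∀ {j t}, t ∈ interior (ψ.interval j) → j ≠ J + 1 ∧ t ∈ interior (φ.interval j) := by
    intro j t ht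
    by_cases hj : j = J + 1
    · subst hj
      have hle : ψ.interval (J + 1) ⊆ {b} := fun s hs => heq s hs
      have := interior_mono hle ht
      simp at this
    · exact ⟨hj, interior_mono (fun t ht => hdom hj t ht) ht⟩
  refine ⟨ψ, ⟨Or.inr hφ.zero_mem, ?_, ?_, ?_, ?_⟩, rfl, hagree⟩
  · have := hφ.init
    rwa [← hagree 0 0 hφ.zero_mem] at this
  · intro j t ht
    simp only [ψ, (hint ht).1, if_false]
    exact hφ.flow_mem j t (hint ht).2
  · intro j
    filter_upwards [hφ.flow_deriv j] with t ht htm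
    simp only [ψ, (hint htm).1, if_false]
    exact ht (hint htm).2
  · intro t j h1 h2
    have hj : j ≠ J + 1 := by
      rintro rfl
      rcases h2 with h2 | h2
      · simp at h2
      · have := (hmax _ h2).2
        simp only at this
        omega
    have h1' := hdom hj t h1
    change (if j = J + 1 then _ else _) ∈ _ ∧ (if j + 1 = J + 1 then _ else _) ∈
      HybridSystem.jumpMap _ (if j = J + 1 then _ else _)
    rw [hagree t j h1']
    by_cases hjJ : j = J
    · subst hjJ
      rw [if_pos rfl, heq t h2]
      exact ⟨Set.mem_iUnion.2 ⟨i, hi⟩, i, hi, rfl⟩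
    · have h2' : (t, j + 1) ∈ φ.dom := hdom (by omega) t h2
      rw [hagree t _ h2']
      exact hφ.jump t j h1' h2'

/-- From a state in the flow set and outside the jump set, the flow dynamics stay in the flow set
for a positive time. -/
theorem exists_flow_χ_nonneg (hσ : ∀ i, 0 < σ i) {q : NetState N} (hq : ∀ i, 0 ≤ q.χ i)
    (hD : ∀ i, q ∉ triggerSet i) :
    ∃ δ > 0, ∀ τ ∈ Set.Ioo 0 δ, ∀ i, 0 ≤ (𝒢.flow σ q τ).χ i := by
  have : ∀ᶠ τ in nhdsWithin (0 : ℝ) (Set.Ioi 0), ∀ i, 0 ≤ (𝒢.flow σ q τ).χ i := by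
    rw [Filter.eventually_all]
    intro i
    -- If `χ_i = 0`, being outside the jump set forces `e_i = 0`, and then `χ_i` at time `τ` is at
    -- least `τ φ̂_i (σ_i - τ d_i)`. If `χ_i > 0`, continuity suffices.
    rcases (hq i).eq_or_lt with h0 | hpos
    · have he : q.e i = 0 := by
        by_contra hne
        exact hD i ⟨h0.symm, fun h => hne (by rw [NetState.e, h, sub_self])⟩
      have hlt : ∀ᶠ τ in nhdsWithin (0 : ℝ) (Set.Ioi 0), τ * 𝒢.outDegree i < σ i := by
        have hc : Continuous fun τ : ℝ => τ * 𝒢.outDegree i := by fun_prop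
        exact nhdsWithin_le_nhds ((hc.tendsto 0).eventually_lt_const (by simpa using hσ i))
      filter_upwards [hlt, self_mem_nhdsWithin] with τ hτ hτ0
      have hτ0 : 0 < τ := hτ0
      rw [flow_χ, ← h0, WeightedDigraph.clockRate, he]
      have hz := 𝒢.zhat_sq_le q i
      have hF := 𝒢.phihat_nonneg q i
      have h1 : τ ^ 2 * 𝒢.zhat q i ^ 2 ≤ τ ^ 2 * (𝒢.outDegree i * 𝒢.phihat q i) :=
        mul_le_mul_of_nonneg_left hz (by positivity)
      have h2 := mul_nonneg (mul_nonneg hτ0.le hF) (sub_nonneg.2 hτ.le)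
      nlinarith
    · have hc : Continuous fun τ => (𝒢.flow σ q τ).χ i := by
        simp only [flow_χ]; fun_prop
      have := (hc.tendsto 0).eventually_const_lt (u := 0) (by simpa [flow_zero] using hpos)
      filter_upwards [nhdsWithin_le_nhds this] with τ h using le_of_lt h
  rw [eventually_nhdsWithin_iff, Metric.eventually_nhds_iff] at this
  obtain ⟨δ, hδ, h⟩ := this
  refine ⟨δ, hδ, fun τ hτ => h ?_ hτ.1⟩
  rw [Real.dist_eq, sub_zero, abs_of_pos hτ.1]
  exact hτ.2

/-- Maximal solutions of the closed loop exist for arbitrarily large times. -/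
theorem HybridSystem.IsMaximalSolution.exists_le_time (hσ : ∀ i, 0 < σ i)
    (hφ : (closedLoop 𝒢 σ).IsMaximalSolution φ) (hinit : IsInitialized (φ.toFun 0 0)) (T : ℝ) :
    ∃ (t : ℝ) (j : ℕ), (t, j) ∈ φ.dom ∧ T ≤ t := by
  by_contra! hT
  obtain ⟨hsol, hmax⟩ := hφ
  have hE := φ.isHybridTimeDomain
  obtain ⟨J, ⟨a₀, ha₀⟩, hJ⟩ : ∃ J, (∃ a, (a, J) ∈ φ.dom) ∧ ∀ p ∈ φ.dom, p.2 ≤ J := by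
    have hbdd : BddAbove {j | ∃ a, (a, j) ∈ φ.dom} := by
      refine ⟨⌈T * ∑ i, 𝒢.outDegree i / σ i⌉₊, ?_⟩
      rintro j ⟨a, ha⟩
      have h1 := hsol.jumps_le hσ hinit ha
      have h2 : a * ∑ i, 𝒢.outDegree i / σ i ≤ T * ∑ i, 𝒢.outDegree i / σ i :=
        mul_le_mul_of_nonneg_right (hT a j ha).le
          (Finset.sum_nonneg fun i _ => div_nonneg (𝒢.outDegree_nonneg i) (hσ i).le)
      exact_mod_cast (h1.trans h2).trans (Nat.le_ceil _)
    exact ⟨_, Nat.sSup_mem (s := {j | ∃ a, (a, j) ∈ φ.dom}) ⟨0, 0, hsol.zero_mem⟩ hbdd, fun p hp => le_csSup hbdd ⟨p.1, hp⟩⟩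
  have hbdd : BddAbove (φ.interval J) := ⟨T, fun t ht => (hT t J ht).le⟩
  have hle : ∀ t, (t, J) ∈ φ.dom → t ≤ sSup (φ.interval J) := fun t ht => le_csSup hbdd ht
  set b := sSup (φ.interval J) with hbdef
  -- If the supremum `b` of the last layer is attained, the solution can jump there or flow a little
  -- further. Otherwise the flow through `a₀` adds the end point `b`; the open interval before it is
  -- already in the domain.
  by_cases hb : (b, J) ∈ φ.dom
  · by_cases hD : ∃ i, φ.toFun b J ∈ triggerSet i
    · obtain ⟨i, hi⟩ := hD
      have hlast : ∀ p ∈ φ.dom, p ≤ (b, J) := by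
        rintro ⟨t, j⟩ hp
        rcases (hJ _ hp).lt_or_eq with h | h
        · exact ⟨hE.le_of_lt hp hb h, h.le⟩
        · simp only at h
          subst h
          exact ⟨hle t hp, le_rfl⟩
      obtain ⟨ψ, hψ, hdom, hagree⟩ := hsol.exists_jump_extension hb hlast hi
      refine hmax ⟨ψ, hψ, ?_, hagree⟩
      rw [hdom]
      refine Set.ssubset_insert fun h => ?_
      have := hJ _ h
      simp at this
    · obtain ⟨δ, hδ, h⟩ := exists_flow_χ_nonneg (𝒢 := 𝒢) hσ
        (fun i => hsol.χ_nonneg hinit hb i) (not_exists.1 hD)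
      obtain ⟨ψ, hψ, hdom, hagree⟩ := hsol.exists_flow_extension hinit hb (c := b + δ)
        (by linarith) hJ (fun t ht => (hle t ht).trans (by linarith))
        (fun t ht => h _ ⟨by linarith [ht.1], by linarith [ht.2]⟩)
      refine hmax ⟨ψ, hψ, ?_, hagree⟩
      rw [hdom]
      refine Set.ssubset_iff_subset_ne.2 ⟨Set.subset_union_left, fun h => ?_⟩
      have : (b + δ, J) ∈ φ.dom := h ▸ Or.inr ⟨⟨by simp only; linarith, le_rfl⟩, rfl⟩
      linarith [hle _ this]
  · obtain ⟨ψ, hψ, hdom, hagree⟩ := hsol.exists_flow_extension hinit ha₀ (hle _ ha₀) hJ hle (by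
      intro t ht i
      obtain ⟨r, hr, htr⟩ := exists_lt_of_lt_csSup ⟨a₀, ha₀⟩ ht.2
      have hmem : (t, J) ∈ φ.dom := hE.mem_of_mem_Icc ha₀ hr ⟨ht.1.le, htr.le⟩
      rw [← hsol.flow_eq ha₀ hmem]
      exact hsol.χ_nonneg hinit hmem i)
    refine hmax ⟨ψ, hψ, ?_, hagree⟩
    rw [hdom]
    refine Set.ssubset_iff_subset_ne.2 ⟨Set.subset_union_left, fun h => ?_⟩
    exact hb (h ▸ Or.inr ⟨⟨hle _ ha₀, le_rfl⟩, rfl⟩)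

end Extension

/-! ### The Lyapunov function and the size of broadcasts -/

section Lyapunov

variable {N : ℕ} {𝒢 : WeightedDigraph N} {σ : Fin N → ℝ} {φ : HybridArc (NetState N)}

/-- The Lyapunov function `∑ i, (x_i² + χ_i)`. -/
noncomputable def lyapunov (q : NetState N) : ℝ := ∑ i, (q.x i ^ 2 + q.χ i)

theorem lyapunov_nonneg {q : NetState N} (hq : ∀ i, 0 ≤ q.χ i) : 0 ≤ lyapunov q :=
  Finset.sum_nonneg fun i _ => add_nonneg (sq_nonneg _) (hq i)

theorem lyapunov_broadcast (i : Fin N) (q : NetState N) :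
    lyapunov (broadcast i q) = lyapunov q := by
  simp only [lyapunov, broadcast_x, broadcast_χ]

/-- Expanding the squares, the two sides differ by `∑ w_ij x̂_i² - ∑ w_ij x̂_j²`, which vanishes
when out-degrees equal in-degrees. -/
theorem WeightedDigraph.IsWeightBalanced.two_mul_sum_xhat_mul_zhat (hbal : 𝒢.IsWeightBalanced)
    (q : NetState N) : 2 * ∑ i, q.xhat i * 𝒢.zhat q i = ∑ i, 𝒢.phihat q i := by
  have h : ∑ i, ∑ j, 𝒢.w i j * q.xhat i ^ 2 = ∑ i, ∑ j, 𝒢.w i j * q.xhat j ^ 2 := by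
    rw [Finset.sum_comm (f := fun i j => 𝒢.w i j * q.xhat j ^ 2)]
    refine Finset.sum_congr rfl fun i _ => ?_
    rw [← Finset.sum_mul, ← Finset.sum_mul, hbal i]
  rw [← sub_eq_zero] at h ⊢
  rw [← h]
  simp only [WeightedDigraph.zhat, WeightedDigraph.phihat, Finset.mul_sum,
    ← Finset.sum_sub_distrib]
  exact Finset.sum_congr rfl fun i _ => Finset.sum_congr rfl fun j _ => by ring

/-- The `τ²` terms of `x_i²` and `χ_i` cancel, and so do the terms `x_i ẑ_i`; only `x̂_i ẑ_i`
remains, to which weight balance applies. -/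
theorem lyapunov_flow (hbal : 𝒢.IsWeightBalanced) (q : NetState N) (τ : ℝ) :
    lyapunov (𝒢.flow σ q τ) = lyapunov q - τ * ∑ i, (1 - σ i) * 𝒢.phihat q i := by
  have h := hbal.two_mul_sum_xhat_mul_zhat q
  have h1 : lyapunov (𝒢.flow σ q τ) = lyapunov q - τ * (2 * ∑ i, q.xhat i * 𝒢.zhat q i -
      ∑ i, σ i * 𝒢.phihat q i) := by
    simp only [lyapunov, flow_x, flow_χ, WeightedDigraph.clockRate, NetState.e, Finset.mul_sum,
      ← Finset.sum_sub_distrib]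
    exact Finset.sum_congr rfl fun i _ => by ring
  rw [h1, h, ← Finset.sum_sub_distrib]
  simp only [sub_mul, one_mul]

theorem lyapunov_flow_le (hbal : 𝒢.IsWeightBalanced) (hσ : ∀ i, σ i < 1) (q : NetState N) {τ : ℝ}
    (hτ : 0 ≤ τ) (i : Fin N) :
    lyapunov (𝒢.flow σ q τ) ≤ lyapunov q - τ * ((1 - σ i) * 𝒢.phihat q i) := by
  rw [lyapunov_flow hbal]
  refine sub_le_sub_left (mul_le_mul_of_nonneg_left ?_ hτ) _
  exact Finset.single_le_sum (f := fun i => (1 - σ i) * 𝒢.phihat q i)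
    (fun k _ => mul_nonneg (sub_nonneg.2 (hσ k).le) (𝒢.phihat_nonneg q k)) (Finset.mem_univ i)

namespace HybridSystem.IsSolution

theorem lyapunov_antitone (hφ : (closedLoop 𝒢 σ).IsSolution φ) (hbal : 𝒢.IsWeightBalanced)
    (hσ : ∀ i, σ i < 1) {s t : ℝ} {i j : ℕ} (hs : (s, i) ∈ φ.dom) (ht : (t, j) ∈ φ.dom)
    (hst : s ≤ t) (hij : i ≤ j) : lyapunov (φ.toFun t j) ≤ lyapunov (φ.toFun s i) := by
  refine φ.isHybridTimeDomain.induction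
    (P := fun t j => lyapunov (φ.toFun t j) ≤ lyapunov (φ.toFun s i)) hs le_rfl ?_ ?_ ht hst hij
  · intro a b j ha hb _ _ hab ih
    rw [hφ.flow_eq ha hb, lyapunov_flow hbal]
    refine le_trans (sub_le_self _ (mul_nonneg (sub_nonneg.2 hab) ?_)) ih
    exact Finset.sum_nonneg fun k _ =>
      mul_nonneg (sub_nonneg.2 (hσ k).le) (𝒢.phihat_nonneg _ k)
  · intro t j h1 h2 _ _ ih
    obtain ⟨k, -, hk⟩ := (hφ.jump t j h1 h2).2
    rwa [hk, lyapunov_broadcast]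

/-- After a broadcast of agent `i`, its error is controlled by the decrease of the Lyapunov
function. -/
theorem e_sq_le_lyapunov_sub (hφ : (closedLoop 𝒢 σ).IsSolution φ)
    (hinit : IsInitialized (φ.toFun 0 0)) (hbal : 𝒢.IsWeightBalanced)
    (hσ : ∀ i, σ i ∈ Set.Ioo (0 : ℝ) 1) (i : Fin N) {s t : ℝ} {k j : ℕ} (hs : (s, k) ∈ φ.dom)
    (hχ : (φ.toFun s k).χ i = 0) (he : (φ.toFun s k).e i = 0) (ht : (t, j) ∈ φ.dom)
    (hst : s ≤ t) (hkj : k ≤ j) :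
    (1 - σ i) * (φ.toFun t j).e i ^ 2 ≤
      σ i * (lyapunov (φ.toFun s k) - lyapunov (φ.toFun t j)) := by
  have h1σ : 0 < 1 - σ i := sub_pos.2 (hσ i).2
  -- Along a flow `χ_i + e_i²` gains `σ_i φ̂_i` per unit time while `V` loses at least `(1 - σ_i)
  -- φ̂_i`. A jump keeps `V` and can only lower `e_i²`.
  have key : (1 - σ i) * ((φ.toFun t j).χ i + (φ.toFun t j).e i ^ 2) ≤
      σ i * (lyapunov (φ.toFun s k) - lyapunov (φ.toFun t j)) := by
    refine φ.isHybridTimeDomain.induction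
      (P := fun t j => (1 - σ i) * ((φ.toFun t j).χ i + (φ.toFun t j).e i ^ 2) ≤
        σ i * (lyapunov (φ.toFun s k) - lyapunov (φ.toFun t j))) hs ?_ ?_ ?_ ht hst hkj
    · simp [hχ, he]
    · intro a b j ha hb _ _ hab ih
      rw [hφ.flow_eq ha hb, flow_χ_add_e_sq]
      have h1 := lyapunov_flow_le hbal (fun i => (hσ i).2) (φ.toFun a j) (sub_nonneg.2 hab) i
        (σ := σ)
      have h2 := mul_le_mul_of_nonneg_left h1 (hσ i).1.le
      nlinarith
    · intro t j h1 h2 _ _ ih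
      obtain ⟨l, -, hl⟩ := (hφ.jump t j h1 h2).2
      rw [hl, lyapunov_broadcast, broadcast_χ]
      refine le_trans (mul_le_mul_of_nonneg_left ?_ h1σ.le) ih
      by_cases hil : i = l
      · subst hil
        rw [broadcast_e_self]
        nlinarith [sq_nonneg ((φ.toFun t j).e i)]
      · rw [broadcast_e_of_ne hil]
  refine le_trans (mul_le_mul_of_nonneg_left ?_ h1σ.le) key
  linarith [hφ.χ_nonneg hinit ht i]

/-- During a time shorter than the minimal time between broadcasts of agent `i`, its last
broadcast state changes at most once. -/
theorem abs_xhat_sub_le (hφ : (closedLoop 𝒢 σ).IsSolution φ)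
    (hinit : IsInitialized (φ.toFun 0 0)) {i : Fin N} (hσ : 0 < σ i) {s δ τ : ℝ} {k : ℕ}
    (hs : (s, k) ∈ φ.dom) (hδ : 0 ≤ δ) (hτ : τ * 𝒢.outDegree i < σ i)
    (hjump : ∀ t j, (t, j) ∈ φ.dom → (t, j + 1) ∈ φ.dom → s ≤ t → k ≤ j →
      φ.toFun t j ∈ triggerSet i → φ.toFun t (j + 1) = broadcast i (φ.toFun t j) →
        |(φ.toFun t j).e i| ≤ δ)
    {t : ℝ} {j : ℕ} (ht : (t, j) ∈ φ.dom) (hst : s ≤ t) (hkj : k ≤ j) (htτ : t ≤ s + τ) :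
    |(φ.toFun t j).xhat i - (φ.toFun s k).xhat i| ≤ δ := by
  -- Either `x̂_i` has not moved, or it moved once and the error bound runs from a reset at some `r
  -- ≥ s`. A second trigger would then give `σ_i ≤ (t - r) d_i ≤ τ d_i < σ_i`.
  have key : t ≤ s + τ → ((φ.toFun t j).xhat i = (φ.toFun s k).xhat i ∨
      |(φ.toFun t j).xhat i - (φ.toFun s k).xhat i| ≤ δ ∧
        ∃ r, s ≤ r ∧ r ≤ t ∧ ErrorBound 𝒢 σ i r t (φ.toFun t j)) := by
    refine φ.isHybridTimeDomain.induction
      (P := fun t j => t ≤ s + τ → ((φ.toFun t j).xhat i = (φ.toFun s k).xhat i ∨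
      |(φ.toFun t j).xhat i - (φ.toFun s k).xhat i| ≤ δ ∧
        ∃ r, s ≤ r ∧ r ≤ t ∧ ErrorBound 𝒢 σ i r t (φ.toFun t j))) hs (fun _ => Or.inl rfl)
      ?_ ?_ ht hst hkj
    · intro a b j ha hb _ _ hab ih hbτ
      rw [hφ.flow_eq ha hb, flow_xhat]
      refine (ih (hab.trans hbτ)).imp_right ?_
      rintro ⟨h1, r, hsr, hra, hr⟩
      refine ⟨h1, r, hsr, hra.trans hab, ?_⟩
      have := hr.flow hσ hra (sub_nonneg.2 hab) (hφ.χ_nonneg hinit ha i)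
      rwa [add_sub_cancel] at this
    · intro t j h1 h2 hst hkj ih htτ
      obtain ⟨l, hl, hl'⟩ := (hφ.jump t j h1 h2).2
      by_cases hil : i = l
      · subst hil
        refine Or.inr ⟨?_, t, hst, le_rfl, ErrorBound.of_e_eq_zero le_rfl
          (hφ.χ_nonneg hinit h2 i) (by rw [hl', broadcast_e_self])⟩
        rcases ih htτ with h | ⟨-, r, hsr, -, hr⟩
        · rw [← h, hl', broadcast_xhat_self]
          exact hjump t j h1 h2 hst hkj hl hl'
        · have h3 := hr.le_of_mem_triggerSet hl
          have h4 : (t - r) * 𝒢.outDegree i ≤ τ * 𝒢.outDegree i :=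
            mul_le_mul_of_nonneg_right (by linarith) (𝒢.outDegree_nonneg i)
          linarith
      · rw [hl', broadcast_xhat_of_ne hil]
        refine (ih htτ).imp_right ?_
        rintro ⟨h3, r, hsr, hrt, hr⟩
        exact ⟨h3, r, hsr, hrt, hr.broadcast_of_ne hil⟩
  rcases key htτ with h | h
  · simpa [h] using hδ
  · exact h.1

end HybridSystem.IsSolution

end Lyapunov

/-! ### Consensus of the broadcast states -/

section Convergence

open Filter

variable {N : ℕ} {𝒢 : WeightedDigraph N} {σ : Fin N → ℝ} {φ : HybridArc (NetState N)}

/-- Directedness makes `atTop` on the domain mean "from some point of the trajectory on". -/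
instance (φ : HybridArc (NetState N)) : IsDirectedOrder φ.dom :=
  ⟨fun p q => (φ.isHybridTimeDomain.2 p p.2 q q.2).elim (fun h => ⟨q, h, le_rfl⟩)
    fun h => ⟨p, le_rfl, h⟩⟩

/-- The value of a hybrid arc at a point of its domain. -/
def HybridArc.at (φ : HybridArc (NetState N)) (p : φ.dom) : NetState N := φ.toFun p.1.1 p.1.2

namespace HybridSystem.IsSolution

/-- The broadcasts of agent `i` have arbitrarily small size from some point on. -/
theorem eventually_jump_small (hφ : (closedLoop 𝒢 σ).IsSolution φ)
    (hinit : IsInitialized (φ.toFun 0 0)) (hbal : 𝒢.IsWeightBalanced)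
    (hσ : ∀ i, σ i ∈ Set.Ioo (0 : ℝ) 1) (i : Fin N) {δ m : ℝ} (hδ : 0 < δ)
    (hm : ∀ p, m ≤ lyapunov (φ.at p)) (hm' : ∀ η > m, ∀ᶠ p in atTop, lyapunov (φ.at p) < η) :
    ∀ᶠ p : φ.dom in atTop, ∀ t j, (t, j) ∈ φ.dom → (t, j + 1) ∈ φ.dom → p.1.1 ≤ t → p.1.2 ≤ j →
      φ.toFun t j ∈ triggerSet i → φ.toFun t (j + 1) = broadcast i (φ.toFun t j) →
        |(φ.toFun t j).e i| ≤ δ := by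
  have : Nonempty φ.dom := ⟨⟨_, hφ.zero_mem⟩⟩
  have h1σ : 0 < 1 - σ i := sub_pos.2 (hσ i).2
  have h0σ := (hσ i).1
  -- With `V` within this margin of `m`, the bound `(1 - σ_i) e_i² ≤ σ_i (V(s) - V(t))` yields `e_i²
  -- ≤ δ²`.
  have hη : m < m + (1 - σ i) * δ ^ 2 / σ i := by
    have : 0 < (1 - σ i) * δ ^ 2 / σ i := by positivity
    linarith
  obtain ⟨p₀, hp₀⟩ := eventually_atTop.1 (hm' _ hη)
  rw [eventually_atTop]
  -- One late broadcast of `i` serves as the reset from which all subsequent ones are estimated. If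
  -- there is none, the claim is vacuous.
  by_cases hjump : ∃ t j, (t, j) ∈ φ.dom ∧ (t, j + 1) ∈ φ.dom ∧ p₀.1.1 ≤ t ∧ p₀.1.2 ≤ j ∧
      φ.toFun t j ∈ triggerSet i ∧ φ.toFun t (j + 1) = broadcast i (φ.toFun t j)
  · obtain ⟨s, k, hs, hs', hps, hpk, hχ, hb⟩ := hjump
    refine ⟨⟨(s, k + 1), hs'⟩, fun p hp t j ht _ hpt hpj _ _ => ?_⟩
    have hle := hφ.e_sq_le_lyapunov_sub hinit hbal hσ i hs' (by rw [hb, broadcast_χ, hχ.1])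
      (by rw [hb, broadcast_e_self]) ht (hp.1.trans hpt) (hp.2.trans hpj)
    have h1 : lyapunov (φ.toFun s (k + 1)) < _ := hp₀ ⟨(s, k + 1), hs'⟩ ⟨hps, hpk.trans k.le_succ⟩
    have h2 : m ≤ lyapunov (φ.toFun t j) := hm ⟨(t, j), ht⟩
    have h3 : σ i * (lyapunov (φ.toFun s (k + 1)) - lyapunov (φ.toFun t j)) ≤
        σ i * ((1 - σ i) * δ ^ 2 / σ i) := mul_le_mul_of_nonneg_left (by linarith) h0σ.le
    rw [mul_div_cancel₀ _ h0σ.ne'] at h3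
    exact abs_le_of_sq_le_sq (le_of_mul_le_mul_left (hle.trans h3) h1σ) hδ.le
  · refine ⟨p₀, fun p hp t j ht ht' hpt hpj hχ hb => ?_⟩
    exact absurd ⟨t, j, ht, ht', hp.1.trans hpt, hp.2.trans hpj, hχ, hb⟩ hjump

end HybridSystem.IsSolution

/-- The difference of the last broadcast states along an edge tends to zero. -/
theorem HybridSystem.IsMaximalSolution.eventually_edge_small
    (hφ : (closedLoop 𝒢 σ).IsMaximalSolution φ) (hinit : IsInitialized (φ.toFun 0 0))
    (hbal : 𝒢.IsWeightBalanced) (hσ : ∀ i, σ i ∈ Set.Ioo (0 : ℝ) 1) {a b : Fin N}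
    (hab : 0 < 𝒢.w a b) {ε : ℝ} (hε : 0 < ε) :
    ∀ᶠ p : φ.dom in atTop, |(φ.at p).xhat a - (φ.at p).xhat b| < ε := by
  have hsol := hφ.1
  have : Nonempty φ.dom := ⟨⟨_, hsol.zero_mem⟩⟩
  have hbdd : BddBelow (Set.range fun p => lyapunov (φ.at p)) := by
    refine ⟨0, ?_⟩
    rintro _ ⟨p, rfl⟩
    exact lyapunov_nonneg fun i => hsol.χ_nonneg hinit p.2 i
  have hanti : Antitone fun p => lyapunov (φ.at p) := fun p q hpq =>
    hsol.lyapunov_antitone hbal (fun i => (hσ i).2) p.2 q.2 hpq.1 hpq.2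
  set m := ⨅ p, lyapunov (φ.at p)
  have hm : ∀ p, m ≤ lyapunov (φ.at p) := fun p => ciInf_le hbdd p
  have hm' : ∀ η > m, ∀ᶠ p in atTop, lyapunov (φ.at p) < η := fun η hη =>
    (tendsto_atTop_ciInf hanti hbdd).eventually_lt_const hη
  obtain ⟨τa, hτa, hτa'⟩ := exists_pos_mul_lt (hσ a).1 (𝒢.outDegree a)
  obtain ⟨τb, hτb, hτb'⟩ := exists_pos_mul_lt (hσ b).1 (𝒢.outDegree b)
  set τ := min τa τb
  have hτ : 0 < τ := lt_min hτa hτb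
  have hτ1 : τ * 𝒢.outDegree a < σ a := lt_of_le_of_lt
    (mul_le_mul_of_nonneg_right (min_le_left _ _) (𝒢.outDegree_nonneg a)) (mul_comm τa _ ▸ hτa')
  have hτ2 : τ * 𝒢.outDegree b < σ b := lt_of_le_of_lt
    (mul_le_mul_of_nonneg_right (min_le_right _ _) (𝒢.outDegree_nonneg b)) (mul_comm τb _ ▸ hτb')
  have h1σ : 0 < 1 - σ a := sub_pos.2 (hσ a).2
  -- While the gap is at least `ε/2`, the edge `(a, b)` alone makes `V` decrease at rate at least
  -- `c`.
  set c := (1 - σ a) * (𝒢.w a b * (ε / 2) ^ 2) with hc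
  have hcpos : 0 < c := by positivity
  have hε4 : 0 < ε / 4 := by positivity
  have hτc : m < m + τ * c := by
    have := mul_pos hτ hcpos
    linarith
  filter_upwards [hsol.eventually_jump_small hinit hbal hσ a hε4 hm hm',
    hsol.eventually_jump_small hinit hbal hσ b hε4 hm hm', hm' _ hτc]
  rintro ⟨⟨s, k⟩, hs⟩ hja hjb hV
  simp only at hja hjb
  by_contra! hbig
  have hfar : ∀ {t : ℝ} {j : ℕ}, (t, j) ∈ φ.dom → s ≤ t → k ≤ j → t ≤ s + τ →
      𝒢.w a b * (ε / 2) ^ 2 ≤ 𝒢.phihat (φ.toFun t j) a := by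
    intro t j ht hst hkj htτ
    have h1 := hsol.abs_xhat_sub_le hinit (hσ a).1 hs hε4.le hτ1 hja ht hst hkj htτ
    have h2 := hsol.abs_xhat_sub_le hinit (hσ b).1 hs hε4.le hτ2 hjb ht hst hkj htτ
    have hbig' : ε ≤ |(φ.toFun s k).xhat a - (φ.toFun s k).xhat b| := hbig
    have h3 : ε / 2 ≤ |(φ.toFun t j).xhat a - (φ.toFun t j).xhat b| := by
      rw [abs_le] at h1 h2
      rcases le_abs.1 hbig' with h | h
      · exact le_abs.2 (Or.inl (by linarith [h1.1, h2.2]))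
      · exact le_abs.2 (Or.inr (by linarith [h1.2, h2.1]))
    have h4 : (ε / 2) ^ 2 ≤ ((φ.toFun t j).xhat a - (φ.toFun t j).xhat b) ^ 2 := by
      rw [← sq_abs ((φ.toFun t j).xhat a - _)]
      exact pow_le_pow_left₀ (by positivity) h3 2
    refine (mul_le_mul_of_nonneg_left h4 hab.le).trans ?_
    exact Finset.single_le_sum
      (f := fun l => 𝒢.w a l * ((φ.toFun t j).xhat a - (φ.toFun t j).xhat l) ^ 2)
      (fun l _ => mul_nonneg (𝒢.nonneg a l) (sq_nonneg _)) (Finset.mem_univ b)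
  obtain ⟨T, J, hT, hsT⟩ := hφ.exists_le_time (fun i => (hσ i).1) hinit (s + τ)
  have hkJ : k ≤ J := by
    rcases φ.isHybridTimeDomain.2 _ hs _ hT with h | h
    · exact h.2
    · have := h.1
      simp only at this
      linarith
  obtain ⟨j, hkj, hj⟩ := φ.isHybridTimeDomain.exists_mem hs hT hkJ (by linarith) hsT
  -- The trivial premise is the induction predicate at the end of the window; before that it
  -- confines the estimate `hfar` to the window.
  have key : s + τ ≤ s + τ → lyapunov (φ.toFun (s + τ) j) ≤
      lyapunov (φ.toFun s k) - (s + τ - s) * c := by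
    refine φ.isHybridTimeDomain.induction (P := fun t j => t ≤ s + τ →
      lyapunov (φ.toFun t j) ≤ lyapunov (φ.toFun s k) - (t - s) * c) hs (by simp) ?_ ?_ hj
      (by linarith) hkj
    · intro a' b' j ha hb hsa hkj hab' ih hbτ
      have h1 := ih (hab'.trans hbτ)
      have h2 := lyapunov_flow_le hbal (fun i => (hσ i).2) (φ.toFun a' j) (sub_nonneg.2 hab') a
        (σ := σ)
      have h3 := mul_le_mul_of_nonneg_left (mul_le_mul_of_nonneg_left
        (hfar ha hsa hkj (hab'.trans hbτ)) h1σ.le) (sub_nonneg.2 hab')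
      rw [← hc] at h3
      rw [hsol.flow_eq ha hb]
      linarith
    · intro t j h1 h2 _ _ ih htτ
      obtain ⟨l, -, hl⟩ := (hsol.jump t j h1 h2).2
      rw [hl, lyapunov_broadcast]
      exact ih htτ
  have h1 := key le_rfl
  have h2 : m ≤ lyapunov (φ.toFun (s + τ) j) := hm ⟨_, hj⟩
  have h3 : lyapunov (φ.toFun s k) < m + τ * c := hV
  rw [add_sub_cancel_left] at h1
  linarith

/-- The last broadcast states reach consensus. -/
theorem HybridSystem.IsMaximalSolution.eventually_abs_xhat_sub_lt
    (hφ : (closedLoop 𝒢 σ).IsMaximalSolution φ) (hinit : IsInitialized (φ.toFun 0 0))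
    (hbal : 𝒢.IsWeightBalanced) (hconn : 𝒢.IsStronglyConnected)
    (hσ : ∀ i, σ i ∈ Set.Ioo (0 : ℝ) 1) {ε : ℝ} (hε : 0 < ε) :
    ∀ᶠ p : φ.dom in atTop, ∀ i k, |(φ.at p).xhat i - (φ.at p).xhat k| < ε := by
  rw [eventually_all]
  intro i
  rw [eventually_all]
  intro k
  induction hconn i k generalizing ε with
  | refl => simpa using Eventually.of_forall fun _ => hε
  | tail _ hbc ih =>
    filter_upwards [ih (half_pos hε), hφ.eventually_edge_small hinit hbal hσ hbc (half_pos hε)]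
      with p h1 h2
    calc _ ≤ _ := abs_sub_le _ _ _
      _ < ε / 2 + ε / 2 := add_lt_add h1 h2
      _ = ε := add_halves ε

/-- An eventual property along the domain of a hybrid arc holds for all large `t + j`. -/
theorem HybridArc.exists_of_eventually [Nonempty φ.dom] {P : ℝ → ℕ → Prop}
    (h : ∀ᶠ p : φ.dom in atTop, P p.1.1 p.1.2) :
    ∃ R : ℝ, ∀ (t : ℝ) (j : ℕ), (t, j) ∈ φ.dom → R ≤ t + j → P t j := by
  obtain ⟨⟨⟨s, k⟩, hs⟩, hp⟩ := eventually_atTop.1 h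
  refine ⟨s + k, fun t j ht hR => hp ⟨(t, j), ht⟩ ?_⟩
  rcases φ.isHybridTimeDomain.2 _ hs _ ht with h | h
  · exact h
  -- A point below `(s, k)` with `t + j ≥ s + k` coincides with it.
  · obtain ⟨h1, h2⟩ := h
    simp only at h1 h2
    have h2' : (j : ℝ) ≤ k := by exact_mod_cast h2
    have h3 : s = t := by linarith
    have h4 : (k : ℝ) ≤ j := by linarith
    exact ⟨h3.le, by exact_mod_cast h4⟩

/-- Replacing every `x̂_i` by one of them gives a nearby point of the set. The `n` coordinates each
differ by at most `ε / (n + 1)`, and `n < (n + 1)²`. -/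
theorem infDist_consensusSet_lt {q : NetState N} {ε : ℝ} (hε : 0 < ε)
    (h : ∀ i k, |q.xhat i - q.xhat k| < ε / (Fintype.card (Fin N × Fin 3) + 1)) :
    Metric.infDist q (consensusSet 𝒢) < ε := by
  rcases isEmpty_or_nonempty (Fin N) with hN | ⟨⟨i₀⟩⟩
  · rw [Metric.infDist_zero_of_mem (fun i => hN.elim i)]
    exact hε
  set n : ℝ := (Fintype.card (Fin N × Fin 3) : ℝ)
  have hn : 0 ≤ n := Nat.cast_nonneg _
  have hmem : NetState.mk q.x (fun _ => q.xhat i₀) q.χ ∈ consensusSet 𝒢 := by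
    intro i
    simp [WeightedDigraph.phihat]
  refine (Metric.infDist_le_dist_of_mem hmem).trans_lt ?_
  rw [EuclideanSpace.dist_eq, Real.sqrt_lt' hε]
  have hcoord : ∀ p : Fin N × Fin 3,
      dist (q p) (NetState.mk q.x (fun _ => q.xhat i₀) q.χ p) ^ 2 ≤ (ε / (n + 1)) ^ 2 := by
    rintro ⟨i, k⟩
    refine pow_le_pow_left₀ dist_nonneg ?_ 2
    fin_cases k
    · simpa [NetState.mk, NetState.x] using by positivity
    · simpa [NetState.mk, NetState.xhat, Real.dist_eq] using (h i i₀).le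
    · simpa [NetState.mk, NetState.χ] using by positivity
  refine (Finset.sum_le_sum fun p _ => hcoord p).trans_lt ?_
  rw [Finset.sum_const, Finset.card_univ, nsmul_eq_mul, div_pow, ← mul_div_assoc,
    div_lt_iff₀ (by positivity), mul_comm]
  have : 0 < ε ^ 2 := by positivity
  refine mul_lt_mul_of_pos_left ?_ this
  change n < (n + 1) ^ 2
  nlinarith

end Convergence

theorem theorem2 {N : ℕ} (𝒢 : WeightedDigraph N)
    (hbal : 𝒢.IsWeightBalanced) (hconn : 𝒢.IsStronglyConnected)
    (σ : Fin N → ℝ) (hσ : ∀ i, σ i ∈ Set.Ioo (0 : ℝ) 1)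
    (φ : HybridArc (NetState N))
    (hφ : (closedLoop 𝒢 σ).IsMaximalSolution φ)
    (hinit : IsInitialized (φ.toFun 0 0)) :
    -- the trajectory exists for all times `t ≥ 0` (in particular there is no Zeno behaviour)
    (∀ T : ℝ, ∃ (t : ℝ) (j : ℕ), (t, j) ∈ φ.dom ∧ T ≤ t) ∧
    -- it converges to the set where all `φ̂_i` vanish
    φ.ConvergesTo (consensusSet 𝒢) ∧
    -- the last broadcast states reach consensus
    (∀ ε > (0 : ℝ), ∃ R : ℝ, ∀ (t : ℝ) (j : ℕ), (t, j) ∈ φ.dom → R ≤ t + j →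
      ∀ i k : Fin N, |(φ.toFun t j).xhat i - (φ.toFun t j).xhat k| < ε) := by
  have : Nonempty φ.dom := ⟨⟨_, hφ.1.zero_mem⟩⟩
  have hcons : ∀ ε > (0 : ℝ), ∃ R : ℝ, ∀ (t : ℝ) (j : ℕ), (t, j) ∈ φ.dom → R ≤ t + j →
      ∀ i k : Fin N, |(φ.toFun t j).xhat i - (φ.toFun t j).xhat k| < ε := fun ε hε =>
    HybridArc.exists_of_eventually
      (P := fun t j => ∀ i k : Fin N, |(φ.toFun t j).xhat i - (φ.toFun t j).xhat k| < ε)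
      (hφ.eventually_abs_xhat_sub_lt hinit hbal hconn hσ hε)
  refine ⟨hφ.exists_le_time (fun i => (hσ i).1) hinit, fun ε hε => ?_, hcons⟩
  obtain ⟨R, hR⟩ := hcons (ε / (Fintype.card (Fin N × Fin 3) + 1)) (by positivity)
  exact ⟨R, fun t j ht hRt => infDist_consensusSet_lt hε (hR t j ht hRt)⟩
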